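/- For $\nu>0$ put $I_\nu=(-1/\nu,1/\nu)$. For $\delta,\nu>0$ let $\tilde{\mathcal O}^{-\delta}(\mathbb D+iI_\nu)$ be the space of all holomorphic functions $F:\mathbb R+iI_\nu\to\mathbb C$ such that for every compact $K\subset I_\nu$ and every $\varepsilon>0$ there is $C>0$ with $|F(z)|\le Ce^{-(\delta-\varepsilon)|\mathrm{Re}\,z|}$ for all $z\in\mathbb R+iK$; its topology is given by the seminorms $F\mapsto\sup_{z\in\mathbb R+iK}e^{(\delta-\varepsilon)|\mathrm{Re}\,z|}|F(z)|$. Let $\mathcal P_*(\mathbb D)=\mathrm{ind}\lim_{n\to\infty}\tilde{\mathcal O}^{-1/n}(\mathbb D+iI_n)$ ($n=1,2,\dots$; inductive limit of locally convex spaces), the space of rapidly decreasing real analytic functions, whose elements are regarded as functions $\mathbb R\to\mathbb C$ by restriction to the real line. Let $(L_p)_{p\ge1}$ be a sequence of real numbers decreasing to $0$, and let $$\prod_{p=1}^\infty\Bigl(1+\frac{L_p^2}{p^2}z^2\Bigr)=\sum_{k=0}^\infty a_kz^k,\qquad z\in\mathbb C .$$ For $\phi\in\mathcal P_*(\mathbb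 D)$ put $$\bigl(P_{L_p}(i\,d/dt)\phi\bigr)(t)=\sum_{k=0}^\infty a_k\,i^k\,\phi^{(k)}(t),\qquad t\in\mathbb R .$$ Then this series converges for every $\phi\in\mathcal P_*(\mathbb D)$ and every $t\in\mathbb R$, and $\phi\mapsto P_{L_p}(i\,d/dt)\phi$ is a continuous linear bijection of $\mathcal P_*(\mathbb D)$ onto itself. -/

import Mathlib

open Set Filter Topology

noncomputable section

namespace FourierHyperfunction

/-- The strip `ℝ + i I_ν`, where `I_ν = (-1/ν, 1/ν)`. -/
def strip (ν : ℝ) : Set ℂ := {z | z.im ∈ Ioo (-(1 / ν)) (1 / ν)}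

/-- The underlying vector space of `Õ^{-δ}(𝔻 + i I_ν)`: the holomorphic functions `F` on the strip
`ℝ + i I_ν` such that for every compact `K ⊆ I_ν` and every `ε > 0` there is a `C` with
`|F(z)| ≤ C e^{-(δ-ε)|Re z|}` for `z ∈ ℝ + iK`. A function on the strip is represented by the
function on `ℂ` that is equal to it on the strip and vanishes outside of the strip. -/
def decaySubmodule (δ ν : ℝ) : Submodule ℂ (ℂ → ℂ) where
  carrier := {F | DifferentiableOn ℂ F (strip ν) ∧ (∀ z, z ∉ strip ν → F z = 0) ∧
    ∀ K : Set ℝ, IsCompact K → K ⊆ Ioo (-(1 / ν)) (1 / ν) → ∀ ε : ℝ, 0 < ε →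
      ∃ C : ℝ, ∀ z : ℂ, z.im ∈ K → ‖F z‖ ≤ C * Real.exp (-(δ - ε) * |z.re|)}
  zero_mem' := ⟨differentiableOn_const 0, fun _ _ => rfl, fun _ _ _ _ _ => ⟨0, by simp⟩⟩
  add_mem' := by
    rintro F G ⟨hF, hF0, hFb⟩ ⟨hG, hG0, hGb⟩
    refine ⟨hF.add hG, fun z hz => by simp [hF0 z hz, hG0 z hz], fun K hK hKs ε hε => ?_⟩
    obtain ⟨C, hC⟩ := hFb K hK hKs ε hε
    obtain ⟨D, hD⟩ := hGb K hK hKs ε hε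
    refine ⟨C + D, fun z hz => ?_⟩
    calc ‖(F + G) z‖ ≤ ‖F z‖ + ‖G z‖ := norm_add_le _ _
      _ ≤ _ := by rw [add_mul]; exact add_le_add (hC z hz) (hD z hz)
  smul_mem' := by
    rintro c F ⟨hF, hF0, hFb⟩
    refine ⟨hF.const_smul c, fun z hz => by simp [hF0 z hz], fun K hK hKs ε hε => ?_⟩
    obtain ⟨C, hC⟩ := hFb K hK hKs ε hε
    refine ⟨‖c‖ * C, fun z hz => ?_⟩
    calc ‖(c • F) z‖ = ‖c‖ * ‖F z‖ := norm_smul c (F z)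
      _ ≤ _ := by rw [mul_assoc]; exact mul_le_mul_of_nonneg_left (hC z hz) (norm_nonneg c)

/-- The space `Õ^{-δ}(𝔻 + i I_ν)`. A new name for the type, so that it does not carry the topology
of pointwise convergence. -/
def DecaySpace (δ ν : ℝ) : Type := ↥(decaySubmodule δ ν)

instance (δ ν : ℝ) : AddCommGroup (DecaySpace δ ν) :=
  inferInstanceAs (AddCommGroup ↥(decaySubmodule δ ν))

instance (δ ν : ℝ) : Module ℂ (DecaySpace δ ν) :=
  inferInstanceAs (Module ℂ ↥(decaySubmodule δ ν))

/-- The indices of the defining seminorms: a compact `K ⊆ I_ν` and an `ε > 0`. -/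
abbrev SeminormIndex (ν : ℝ) : Type :=
  {K : Set ℝ // IsCompact K ∧ K ⊆ Ioo (-(1 / ν)) (1 / ν)} × {ε : ℝ // 0 < ε}

instance (ν : ℝ) : Nonempty (SeminormIndex ν) :=
  ⟨⟨⟨∅, isCompact_empty, empty_subset _⟩, ⟨1, one_pos⟩⟩⟩

theorem bddAbove_weighted {δ ν : ℝ} (i : SeminormIndex ν) (F : DecaySpace δ ν) :
    BddAbove (range fun z : {z : ℂ // z.im ∈ i.1.1} =>
      Real.exp ((δ - i.2.1) * |z.1.re|) * ‖F.1 z.1‖) := by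
  obtain ⟨C, hC⟩ := F.2.2.2 i.1.1 i.1.2.1 i.1.2.2 i.2.1 i.2.2
  refine ⟨C, ?_⟩
  rintro _ ⟨z, rfl⟩
  have h := mul_le_mul_of_nonneg_left (hC z.1 z.2)
    (Real.exp_pos ((δ - i.2.1) * |z.1.re|)).le
  refine h.trans (le_of_eq ?_)
  rw [mul_left_comm, ← Real.exp_add, neg_mul, add_neg_cancel, Real.exp_zero, mul_one]

/-- The seminorm `F ↦ sup_{z ∈ ℝ + iK} e^{(δ-ε)|Re z|} |F(z)|` on `Õ^{-δ}(𝔻 + i I_ν)`. -/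
def decaySeminorm (δ ν : ℝ) (i : SeminormIndex ν) : Seminorm ℂ (DecaySpace δ ν) :=
  Seminorm.of
    (fun F => ⨆ z : {z : ℂ // z.im ∈ i.1.1}, Real.exp ((δ - i.2.1) * |z.1.re|) * ‖F.1 z.1‖)
    (fun F G => by
      have hF0 : 0 ≤ ⨆ z : {z : ℂ // z.im ∈ i.1.1},
          Real.exp ((δ - i.2.1) * |z.1.re|) * ‖F.1 z.1‖ :=
        Real.iSup_nonneg fun z => by positivity
      have hG0 : 0 ≤ ⨆ z : {z : ℂ // z.im ∈ i.1.1},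
          Real.exp ((δ - i.2.1) * |z.1.re|) * ‖G.1 z.1‖ :=
        Real.iSup_nonneg fun z => by positivity
      refine Real.iSup_le (fun z => ?_) (add_nonneg hF0 hG0)
      refine le_trans ?_ (add_le_add (le_ciSup (bddAbove_weighted i F) z)
        (le_ciSup (bddAbove_weighted i G) z))
      rw [← mul_add]
      exact mul_le_mul_of_nonneg_left (norm_add_le (F.1 z.1) (G.1 z.1)) (Real.exp_pos _).le)
    (fun c F => by
      rw [Real.mul_iSup_of_nonneg (norm_nonneg c)]
      refine iSup_congr fun z => ?_
      have h : ‖(c • F).1 z.1‖ = ‖c‖ * ‖F.1 z.1‖ := norm_smul c (F.1 z.1)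
      rw [h, mul_left_comm])

/-- The (Fréchet) topology of `Õ^{-δ}(𝔻 + i I_ν)`, given by all the seminorms `decaySeminorm`. -/
instance (δ ν : ℝ) : TopologicalSpace (DecaySpace δ ν) :=
  (SeminormFamily.moduleFilterBasis (𝕜 := ℂ) (decaySeminorm δ ν)).topology

theorem mem_decaySubmodule_of_le {m n : ℕ+} (h : m ≤ n) {F : ℂ → ℂ}
    (hF : F ∈ decaySubmodule (1 / (m : ℝ)) m) :
    (strip (n : ℝ)).indicator F ∈ decaySubmodule (1 / (n : ℝ)) n := by
  have hmn : 1 / (n : ℝ) ≤ 1 / (m : ℝ) :=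
    one_div_le_one_div_of_le (by exact_mod_cast m.pos) (by exact_mod_cast h)
  have hI : Ioo (-(1 / (n : ℝ))) (1 / (n : ℝ)) ⊆ Ioo (-(1 / (m : ℝ))) (1 / (m : ℝ)) :=
    Ioo_subset_Ioo (neg_le_neg hmn) hmn
  obtain ⟨h1, -, h3⟩ := hF
  refine ⟨?_, fun z hz => indicator_of_notMem hz F, fun K hK hKs ε hε => ?_⟩
  · exact (h1.mono fun z hz => hI hz).congr fun z hz => indicator_of_mem hz F
  · obtain ⟨C, hC⟩ := h3 K hK (hKs.trans hI) ε hε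
    refine ⟨|C|, fun z hz => ?_⟩
    rw [indicator_of_mem (show z ∈ strip (n : ℝ) from hKs hz)]
    refine (hC z hz).trans (mul_le_mul (le_abs_self C) ?_ (Real.exp_pos _).le (abs_nonneg C))
    exact Real.exp_le_exp.mpr (mul_le_mul_of_nonneg_right (by linarith) (abs_nonneg _))

/-- The underlying vector space of `𝒫_*(𝔻)`, the union of the spaces `Õ^{-1/n}(𝔻 + i I_n)`,
`n = 1, 2, …`: the functions on `ℝ` that extend to an element of some `Õ^{-1/n}(𝔻 + i I_n)`. -/
def pStarSubmodule : Submodule ℂ (ℝ → ℂ) where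
  carrier := {φ | ∃ n : ℕ+, ∃ F ∈ decaySubmodule (1 / (n : ℝ)) n, ∀ x : ℝ, φ x = F x}
  zero_mem' := ⟨1, 0, Submodule.zero_mem _, fun _ => rfl⟩
  add_mem' := by
    rintro φ ψ ⟨m, F, hF, hφ⟩ ⟨n, G, hG, hψ⟩
    have hreal : ∀ x : ℝ, (x : ℂ) ∈ strip ((max m n : ℕ+) : ℝ) := fun x => by
      have : (0 : ℝ) < 1 / ((max m n : ℕ+) : ℝ) :=
        one_div_pos.mpr (by exact_mod_cast (max m n).pos)
      simp only [strip, mem_ofPred_eq, Complex.ofReal_im]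
      exact ⟨by linarith, this⟩
    refine ⟨max m n, _, Submodule.add_mem _ (mem_decaySubmodule_of_le (le_max_left m n) hF)
      (mem_decaySubmodule_of_le (le_max_right m n) hG), fun x => ?_⟩
    simp only [Pi.add_apply, indicator_of_mem (hreal x), hφ, hψ]
  smul_mem' := by
    rintro c φ ⟨n, F, hF, hφ⟩
    exact ⟨n, c • F, Submodule.smul_mem _ c hF, fun x => by simp [hφ]⟩

/-- The space `𝒫_*(𝔻)` of rapidly decreasing real analytic functions. -/
def PStar : Type := ↥pStarSubmodule

instance : AddCommGroup PStar := inferInstanceAs (AddCommGroup ↥pStarSubmodule)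

instance : Module ℂ PStar := inferInstanceAs (Module ℂ ↥pStarSubmodule)

instance : Module ℝ PStar := inferInstanceAs (Module ℝ ↥pStarSubmodule)

instance : CoeFun PStar (fun _ => ℝ → ℂ) := ⟨fun φ => φ.1⟩

/-- The canonical map `Õ^{-1/n}(𝔻 + i I_n) → 𝒫_*(𝔻)`, restriction to the real line. -/
def ofStep (n : ℕ+) (F : DecaySpace (1 / (n : ℝ)) n) : PStar :=
  ⟨fun x => F.1 x, n, F.1, F.2, fun _ => rfl⟩

/-- The topology of `𝒫_*(𝔻) = ind lim_{n → ∞} Õ^{-1/n}(𝔻 + i I_n)`, the inductive limit of locally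
convex spaces: the finest locally convex vector space topology for which all the canonical maps
`Õ^{-1/n}(𝔻 + i I_n) → 𝒫_*(𝔻)` are continuous. -/
instance : TopologicalSpace PStar :=
  sInf {t : TopologicalSpace PStar | (∀ n : ℕ+, @Continuous _ _ _ t (ofStep n)) ∧
    @IsTopologicalAddGroup PStar t _ ∧
    @ContinuousSMul ℂ PStar _ _ t ∧
    @LocallyConvexSpace ℝ PStar _ _ _ _ t}

/-- The entire function `P_L(z) = ∏_{p=1}^∞ (1 + (L_p² / p²) z²)`. -/
def symbol (L : ℕ+ → ℝ) (z : ℂ) : ℂ :=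
  ∏' p : ℕ+, (1 + ((L p : ℂ) ^ 2 / (p : ℂ) ^ 2) * z ^ 2)

/-- The coefficients `a_k` of the expansion `∏_{p=1}^∞ (1 + (L_p² / p²) z²) = ∑_{k=0}^∞ a_k z^k`. -/
def coeff (L : ℕ+ → ℝ) (k : ℕ) : ℂ :=
  iteratedDeriv k (symbol L) 0 / (k.factorial : ℂ)

/-- The `k`-th term of the series `P_L(c d/dt) φ (t) = ∑_{k=0}^∞ a_k c^k φ^{(k)}(t)`. -/
def operatorTerm (L : ℕ+ → ℝ) (c : ℂ) (φ : ℝ → ℂ) (t : ℝ) (k : ℕ) : ℂ :=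
  coeff L k * c ^ k * iteratedDeriv k φ t

end FourierHyperfunction

end

noncomputable section

namespace FourierHyperfunction

open Set Filter Topology MeasureTheory
open scoped ENNReal NNReal FourierTransform

/-! ### The symbol and its Taylor coefficients -/

/-! Since `L` tends to `0`, the symbol `P` is entire of exponential type zero: finitely many factors
grow polynomially, and the tail is compared with the sine product at a small scale
(`exists_norm_symbol_le`). Cauchy's estimates on circles of radius proportional to `k` then give `∑
|a_k| k!/r^k < ∞` for every `r > 0`. Against the bound `|F^(k)| ≤ k!/r^k · sup |F|` this makes the
series converge with no loss of decay rate or strip width, so the operator maps each step space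
continuously into itself. The universal property of the inductive limit gives continuity on `PStar`.

For bijectivity, the Fourier transform turns the operator into multiplication by `P(-2πξ)`
(`fourier_symbolOperator`). On the real line `P ≥ 1`, so the operator is injective. For
surjectivity, `1/P` is a characteristic function: `1/(1 + b²t²)` is that of `b` times a standard
Laplace variable, so `1/P` belongs to the sum of independent Laplace variables scaled by `L_p/p`
(`exists_measure_charFun_eq_inv_symbol`). Its law `μ` has an exponential moment of some order `η >
0`, so convolution with `μ` preserves every step space of decay rate at most `η`
(`measureConv_mem`). Every element of `PStar` lies in such a step, and its convolution with `μ` is a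
preimage. -/

theorem prod_range_one_add_sq_div_sq_le {d : ℝ} (hd : 1 ≤ d) (n : ℕ) :
    ∏ j ∈ Finset.range n, (1 + d ^ 2 / ((j : ℝ) + 1) ^ 2) ≤ Real.exp (Real.pi * d) := by
  have hpd : 1 ≤ Real.pi * d := by nlinarith [Real.pi_gt_three]
  -- Euler's product at `z = i d` gives `π d ∏ (1 + d²/j²) = sinh (π d) ≤ exp (π d)`. The partial
  -- products increase to it, and `π d ≥ 1` allows that factor to be dropped.
  have hlim := (Complex.tendsto_euler_sin_prod (d * Complex.I)).norm
  have hterm : ∀ n : ℕ, ‖(Real.pi : ℂ) * (d * Complex.I) *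
      ∏ j ∈ Finset.range n, ((1 : ℂ) - (d * Complex.I) ^ 2 / ((j : ℂ) + 1) ^ 2)‖ =
      Real.pi * d * ∏ j ∈ Finset.range n, (1 + d ^ 2 / ((j : ℝ) + 1) ^ 2) := by
    intro n
    have : ∏ j ∈ Finset.range n, ((1 : ℂ) - (d * Complex.I) ^ 2 / ((j : ℂ) + 1) ^ 2) =
        ((∏ j ∈ Finset.range n, (1 + d ^ 2 / ((j : ℝ) + 1) ^ 2) : ℝ) : ℂ) := by
      push_cast
      refine Finset.prod_congr rfl fun j _ => ?_
      rw [mul_pow, Complex.I_sq]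
      ring
    have h0 : 0 ≤ ∏ j ∈ Finset.range n, (1 + d ^ 2 / ((j : ℝ) + 1) ^ 2) :=
      Finset.prod_nonneg fun j _ => by positivity
    rw [this, norm_mul, norm_mul, norm_mul, Complex.norm_I, Complex.norm_real, Complex.norm_real,
      Complex.norm_real, Real.norm_of_nonneg h0,
      Real.norm_of_nonneg Real.pi_pos.le, Real.norm_of_nonneg (show 0 ≤ d by linarith), mul_one]
  simp only [hterm] at hlim
  have hmono : Monotone fun n : ℕ =>
      Real.pi * d * ∏ j ∈ Finset.range n, (1 + d ^ 2 / ((j : ℝ) + 1) ^ 2) := by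
    refine monotone_nat_of_le_succ fun n => ?_
    have h0 : 0 ≤ ∏ j ∈ Finset.range n, (1 + d ^ 2 / ((j : ℝ) + 1) ^ 2) :=
      Finset.prod_nonneg fun j _ => by positivity
    have h1 : 0 ≤ d ^ 2 / ((n : ℝ) + 1) ^ 2 := by positivity
    rw [Finset.prod_range_succ]
    refine mul_le_mul_of_nonneg_left ?_ (by linarith)
    nlinarith
  have hle := hmono.ge_of_tendsto hlim n
  have hsin : ‖Complex.sin (Real.pi * (d * Complex.I))‖ ≤ Real.exp (Real.pi * d) := by
    have h0 : 0 ≤ Real.sinh (Real.pi * d) := Real.sinh_nonneg_iff.mpr (by linarith)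
    rw [← mul_assoc, Complex.sin_mul_I, norm_mul, Complex.norm_I, mul_one, ← Complex.ofReal_mul,
      ← Complex.ofReal_sinh, Complex.norm_real, Real.norm_of_nonneg h0, Real.sinh_eq]
    have := Real.exp_pos (-(Real.pi * d))
    have := Real.exp_pos (Real.pi * d)
    linarith
  have h0 : 0 ≤ ∏ j ∈ Finset.range n, (1 + d ^ 2 / ((j : ℝ) + 1) ^ 2) :=
    Finset.prod_nonneg fun j _ => by positivity
  nlinarith

/-- The passage from `c` to `c + 1` meets the requirement `d ≥ 1` of the sine product bound and
costs only a constant factor. -/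
theorem prod_one_add_sq_div_sq_le {c : ℝ} (hc : 0 ≤ c) (s : Finset ℕ+) :
    ∏ p ∈ s, (1 + c ^ 2 / (p : ℝ) ^ 2) ≤ Real.exp (Real.pi * (c + 1)) := by
  obtain ⟨n, hn⟩ := (s.image PNat.natPred).exists_nat_subset_range
  refine le_trans ?_ (prod_range_one_add_sq_div_sq_le (d := c + 1) (by linarith) n)
  have himage : ∏ p ∈ s, (1 + (c + 1) ^ 2 / (p : ℝ) ^ 2) =
      ∏ j ∈ s.image PNat.natPred, (1 + (c + 1) ^ 2 / ((j : ℝ) + 1) ^ 2) := by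
    rw [Finset.prod_image PNat.natPred_injective.injOn]
    refine Finset.prod_congr rfl fun p _ => ?_
    rw [← Nat.cast_add_one, PNat.natPred_add_one]
  calc ∏ p ∈ s, (1 + c ^ 2 / (p : ℝ) ^ 2)
      ≤ ∏ p ∈ s, (1 + (c + 1) ^ 2 / (p : ℝ) ^ 2) :=
        Finset.prod_le_prod (fun p _ => by positivity) fun p _ => by gcongr; linarith
    _ ≤ _ := by
      rw [himage]
      exact Finset.prod_le_prod_of_subset_of_one_le (f := fun j : ℕ => 1 + (c + 1) ^ 2 / ((j : ℝ) + 1) ^ 2)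
        hn (fun j _ => by positivity) fun j _ _ => le_add_of_nonneg_right (by positivity)

theorem exists_prod_one_add_mul_sq_le {ι : Type*} (b : ι → ℝ) (hb : ∀ i, 0 ≤ b i) (s : Finset ι) :
    ∀ ε : ℝ, 0 < ε → ∃ C : ℝ, 0 ≤ C ∧ ∀ r : ℝ, 0 ≤ r →
      ∏ i ∈ s, (1 + b i * r ^ 2) ≤ C * Real.exp (ε * r) := by
  classical
  induction s using Finset.induction_on with
  | empty =>
    intro ε hε
    refine ⟨1, zero_le_one, fun r hr => ?_⟩
    simpa using mul_nonneg hε.le hr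
  | insert i s his ih =>
    intro ε hε
    obtain ⟨C, hC0, hC⟩ := ih (ε / 2) (half_pos hε)
    -- With `u = ε r / 2`, the inequality `u²/2 ≤ exp u` absorbs `b r² = (8b/ε²)(u²/2)`. The other
    -- half of `ε` is left for the remaining factors.
    have hfac : ∀ r : ℝ, 0 ≤ r →
        1 + b i * r ^ 2 ≤ (1 + 8 * b i / ε ^ 2) * Real.exp (ε / 2 * r) := by
      intro r hr
      have h0 : 0 ≤ ε / 2 * r := by positivity
      have hq := Real.quadratic_le_exp_of_nonneg h0
      have hbi : 0 ≤ 8 * b i / ε ^ 2 := by have := hb i; positivity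
      have h1 : 1 ≤ Real.exp (ε / 2 * r) := Real.one_le_exp h0
      have h2 : b i * r ^ 2 = 8 * b i / ε ^ 2 * ((ε / 2 * r) ^ 2 / 2) := by
        field_simp; ring
      rw [h2, add_mul, one_mul]
      refine add_le_add h1 (mul_le_mul_of_nonneg_left ?_ hbi)
      linarith
    refine ⟨(1 + 8 * b i / ε ^ 2) * C, by have := hb i; positivity, fun r hr => ?_⟩
    rw [Finset.prod_insert his]
    refine (mul_le_mul (hfac r hr) (hC r hr) ?_ ?_).trans (le_of_eq ?_)
    · exact Finset.prod_nonneg fun j _ => by have := hb j; positivity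
    · have := hb i; positivity
    · rw [mul_mul_mul_comm, ← Real.exp_add]
      ring_nf

variable {L : ℕ+ → ℝ}

theorem summable_one_div_pnat_sq : Summable fun p : ℕ+ => 1 / (p : ℝ) ^ 2 := by
  have h := Real.summable_one_div_nat_pow.mpr (le_refl 2)
  exact h.comp_injective PNat.coe_injective

theorem summable_sq_div_sq (hL : Antitone L) (hL0 : ∀ p, 0 ≤ L p) :
    Summable fun p : ℕ+ => L p ^ 2 / (p : ℝ) ^ 2 := by
  refine Summable.of_nonneg_of_le (fun p => by positivity) (fun p => ?_)
    (summable_one_div_pnat_sq.mul_left (L 1 ^ 2))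
  rw [mul_one_div]
  have := hL0 p
  have := hL (one_le (a := p))
  gcongr

theorem symbol_factor (L : ℕ+ → ℝ) (p : ℕ+) :
    (L p : ℂ) ^ 2 / (p : ℂ) ^ 2 = ((L p ^ 2 / (p : ℝ) ^ 2 : ℝ) : ℂ) := by
  push_cast; rfl

theorem hasProd_symbol (hs : Summable fun p : ℕ+ => L p ^ 2 / (p : ℝ) ^ 2) (z : ℂ) :
    HasProd (fun p : ℕ+ => 1 + ((L p ^ 2 / (p : ℝ) ^ 2 : ℝ) : ℂ) * z ^ 2) (symbol L z) := by
  have h : Multipliable fun p : ℕ+ => 1 + ((L p ^ 2 / (p : ℝ) ^ 2 : ℝ) : ℂ) * z ^ 2 := by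
    refine multipliable_one_add_of_summable ?_
    simp only [norm_mul, Complex.norm_real]
    exact hs.norm.mul_right _
  simpa only [symbol, symbol_factor] using h.hasProd

theorem differentiable_symbol (hs : Summable fun p : ℕ+ => L p ^ 2 / (p : ℝ) ^ 2) :
    Differentiable ℂ (symbol L) := by
  intro z
  have h := Summable.hasProdLocallyUniformlyOn_one_add (K := Metric.ball (0 : ℂ) (‖z‖ + 1))
    (f := fun (p : ℕ+) (z : ℂ) => ((L p : ℂ) ^ 2 / (p : ℂ) ^ 2) * z ^ 2) Metric.isOpen_ball
    (hs.mul_right ((‖z‖ + 1) ^ 2)) (.of_forall fun p w hw => ?_) (fun p => by fun_prop)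
  · rw [hasProdLocallyUniformlyOn_iff_tendstoLocallyUniformlyOn] at h
    have hd := h.differentiableOn (.of_forall fun s => by fun_prop) Metric.isOpen_ball
    exact hd.differentiableAt (Metric.isOpen_ball.mem_nhds (by simp))
  · rw [symbol_factor, norm_mul, Complex.norm_real, Real.norm_of_nonneg (by positivity), norm_pow]
    have : ‖w‖ ≤ ‖z‖ + 1 := by simpa using (mem_ball_zero_iff.mp hw).le
    gcongr

/-- The symbol is of order one and minimal type. -/
theorem exists_norm_symbol_le (hL0 : ∀ p, 0 ≤ L p) (hlim : Tendsto L atTop (𝓝 0))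
    (hs : Summable fun p : ℕ+ => L p ^ 2 / (p : ℝ) ^ 2) {ε : ℝ} (hε : 0 < ε) :
    ∃ C : ℝ, ∀ z, ‖symbol L z‖ ≤ C * Real.exp (ε * ‖z‖) := by
  classical
  -- The exponent is split in two: for `p ≥ N` one has `L p ≤ η = ε/(2π)`, so the tail has type `π η
  -- = ε/2`; the finitely many factors before `N` take the other `ε/2`.
  obtain ⟨N, hN⟩ := eventually_atTop.mp
    (hlim.eventually (gt_mem_nhds (show 0 < ε / (2 * Real.pi) by positivity)))
  set η := ε / (2 * Real.pi) with hη
  have hη0 : 0 < η := by positivity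
  obtain ⟨C, hC0, hC⟩ := exists_prod_one_add_mul_sq_le (fun p : ℕ+ => L p ^ 2 / (p : ℝ) ^ 2)
    (fun p => by positivity) (Finset.Iio N) (ε / 2) (half_pos hε)
  refine ⟨C * Real.exp Real.pi, fun z => ?_⟩
  refine le_of_tendsto (hasProd_symbol hs z).norm (.of_forall fun s => ?_)
  have hfac : ∀ p : ℕ+, ‖1 + ((L p ^ 2 / (p : ℝ) ^ 2 : ℝ) : ℂ) * z ^ 2‖ ≤
      1 + L p ^ 2 / (p : ℝ) ^ 2 * ‖z‖ ^ 2 := fun p => by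
    refine (norm_add_le _ _).trans_eq ?_
    rw [norm_one, norm_mul, Complex.norm_real, Real.norm_of_nonneg (by positivity), norm_pow]
  have h1 : ∏ p ∈ s with p < N, (1 + L p ^ 2 / (p : ℝ) ^ 2 * ‖z‖ ^ 2) ≤
      C * Real.exp (ε / 2 * ‖z‖) := by
    refine le_trans ?_ (hC ‖z‖ (norm_nonneg z))
    refine Finset.prod_le_prod_of_subset_of_one_le (fun p hp => ?_) (fun p _ => by positivity)
      fun p _ _ => le_add_of_nonneg_right (by positivity)
    simpa using (Finset.mem_filter.mp hp).2
  have h2 : ∏ p ∈ s with ¬ p < N, (1 + L p ^ 2 / (p : ℝ) ^ 2 * ‖z‖ ^ 2) ≤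
      Real.exp (Real.pi * (η * ‖z‖ + 1)) := by
    refine le_trans ?_ (prod_one_add_sq_div_sq_le (c := η * ‖z‖) (by positivity) {p ∈ s | ¬ p < N})
    refine Finset.prod_le_prod (fun p _ => by positivity) fun p hp => ?_
    have hp' : L p ≤ η := (hN p (not_lt.mp (Finset.mem_filter.mp hp).2)).le
    have := hL0 p
    rw [mul_pow, div_mul_eq_mul_div]
    gcongr
  calc ∏ p ∈ s, ‖1 + ((L p ^ 2 / (p : ℝ) ^ 2 : ℝ) : ℂ) * z ^ 2‖
      ≤ ∏ p ∈ s, (1 + L p ^ 2 / (p : ℝ) ^ 2 * ‖z‖ ^ 2) :=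
        Finset.prod_le_prod (fun p _ => norm_nonneg _) fun p _ => hfac p
    _ = (∏ p ∈ s with p < N, (1 + L p ^ 2 / (p : ℝ) ^ 2 * ‖z‖ ^ 2)) *
        ∏ p ∈ s with ¬ p < N, (1 + L p ^ 2 / (p : ℝ) ^ 2 * ‖z‖ ^ 2) :=
        (Finset.prod_filter_mul_prod_filter_not s _ _).symm
    _ ≤ C * Real.exp (ε / 2 * ‖z‖) * Real.exp (Real.pi * (η * ‖z‖ + 1)) :=
        mul_le_mul h1 h2 (Finset.prod_nonneg fun p _ => by positivity) (by positivity)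
    _ = C * Real.exp Real.pi * Real.exp (ε * ‖z‖) := by
        rw [mul_assoc, mul_assoc, ← Real.exp_add, ← Real.exp_add]
        congr 2
        rw [hη]
        field_simp
        ring

theorem hasSum_coeff (hs : Summable fun p : ℕ+ => L p ^ 2 / (p : ℝ) ^ 2) (z : ℂ) :
    HasSum (fun k => coeff L k * z ^ k) (symbol L z) := by
  have h := Complex.hasSum_taylorSeries_of_entire (differentiable_symbol hs) 0 z
  refine h.congr_fun fun k => ?_
  simp only [coeff, sub_zero, smul_eq_mul]
  ring

theorem norm_coeff_le (hs : Summable fun p : ℕ+ => L p ^ 2 / (p : ℝ) ^ 2) {ε C R : ℝ} (hR : 0 < R)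
    (hC : ∀ z, ‖symbol L z‖ ≤ C * Real.exp (ε * ‖z‖)) (k : ℕ) :
    ‖coeff L k‖ ≤ C * Real.exp (ε * R) / R ^ k := by
  have h := Complex.norm_iteratedDeriv_le_of_forall_mem_sphere_norm_le (c := 0) (R := R)
    (C := C * Real.exp (ε * R)) k hR (differentiable_symbol hs).diffContOnCl fun z hz => by
      simpa [mem_sphere_zero_iff_norm.mp hz] using hC z
  rw [coeff, norm_div, Complex.norm_natCast, div_le_iff₀ (by positivity)]
  exact h.trans_eq (by ring)

/-- Minimal type is what makes this work for every `r`: type `ε` gives `|a_k| k! ≤ C (e ε)^k`, with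
`ε` as small as desired. -/
theorem summable_norm_coeff_mul_factorial_div (hL0 : ∀ p, 0 ≤ L p) (hlim : Tendsto L atTop (𝓝 0))
    (hs : Summable fun p : ℕ+ => L p ^ 2 / (p : ℝ) ^ 2) {r : ℝ} (hr : 0 < r) :
    Summable fun k : ℕ => ‖coeff L k‖ * (k.factorial / r ^ k) := by
  -- Chosen so that `e ε / r = 1/2`, the ratio of the majorizing geometric series.
  set ε := r / (2 * Real.exp 1) with hεdef
  have hε : 0 < ε := by positivity
  obtain ⟨C, hC⟩ := exists_norm_symbol_le hL0 hlim hs hε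
  have hC0 : 0 ≤ C := by
    have := (norm_nonneg _).trans (hC 0)
    simpa using this
  refine Summable.of_norm_bounded_eventually_nat (g := fun k => C * (1 / 2 : ℝ) ^ k)
    (summable_geometric_two.mul_left C) ?_
  filter_upwards [eventually_ge_atTop 1] with k hk
  have hk0 : (0 : ℝ) < k := by exact_mod_cast hk
  -- The radius `k/ε` minimizes `exp (ε R) / R^k`; it is positive only for `k ≥ 1`, whence the
  -- restriction to eventual `k`.
  have hck := norm_coeff_le hs (R := k / ε) (by positivity) hC k
  have hfact : (k.factorial : ℝ) ≤ (k : ℝ) ^ k := by exact_mod_cast Nat.factorial_le_pow k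
  rw [Real.norm_of_nonneg (by positivity)]
  calc ‖coeff L k‖ * (k.factorial / r ^ k)
      ≤ (C * Real.exp (ε * (k / ε)) / (k / ε) ^ k) * ((k : ℝ) ^ k / r ^ k) := by gcongr
    _ = C * (1 / 2 : ℝ) ^ k := by
      have h1 : Real.exp (ε * (k / ε)) = Real.exp 1 ^ k := by
        rw [mul_div_cancel₀ _ hε.ne', ← Real.exp_nat_mul, mul_one]
      rw [h1, div_pow, hεdef, div_pow, mul_pow, one_div, inv_pow]
      field_simp

/-- Every factor is real and at least `1` on the real axis, and both properties survive in the
limit. -/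
theorem symbol_ofReal (hs : Summable fun p : ℕ+ => L p ^ 2 / (p : ℝ) ^ 2) (x : ℝ) :
    ∃ y : ℝ, 1 ≤ y ∧ symbol L x = y := by
  have h := hasProd_symbol hs x
  have h' : HasProd (fun p : ℕ+ => 1 + L p ^ 2 / (p : ℝ) ^ 2 * x ^ 2) (symbol L x).re := by
    have := (Complex.continuous_re.tendsto _).comp h
    refine this.congr fun s => ?_
    simp only [Function.comp_apply]
    rw [← Complex.ofReal_re (∏ p ∈ s, _)]
    push_cast
    rfl
  have him : (symbol L x).im = 0 := by
    refine tendsto_nhds_unique ((Complex.continuous_im.tendsto _).comp h)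
      (tendsto_const_nhds.congr fun s => ?_)
    simp only [Function.comp_apply]
    have : ∏ p ∈ s, (1 + ((L p ^ 2 / (p : ℝ) ^ 2 : ℝ) : ℂ) * (x : ℂ) ^ 2) =
        ((∏ p ∈ s, (1 + L p ^ 2 / (p : ℝ) ^ 2 * x ^ 2) : ℝ) : ℂ) := by push_cast; rfl
    rw [this, Complex.ofReal_im]
  refine ⟨(symbol L x).re, ge_of_tendsto h' (.of_forall fun s => ?_), ?_⟩
  · have := Finset.prod_le_prod (s := s) (f := fun _ => (1 : ℝ))
      (g := fun p : ℕ+ => 1 + L p ^ 2 / (p : ℝ) ^ 2 * x ^ 2) (fun _ _ => zero_le_one)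
      fun p _ => le_add_of_nonneg_right (by positivity)
    simpa using this
  · exact Complex.ext (by simp) (by simp [him])

theorem symbol_ofReal_ne_zero (hs : Summable fun p : ℕ+ => L p ^ 2 / (p : ℝ) ^ 2) (x : ℝ) :
    symbol L x ≠ 0 := by
  obtain ⟨y, hy, h⟩ := symbol_ofReal hs x
  rw [h]
  exact_mod_cast (by linarith : y ≠ 0)

/-! ### Differential operators of infinite order on the step spaces -/

variable {δ ν : ℝ}

theorem isOpen_strip (ν : ℝ) : IsOpen (strip ν) :=
  isOpen_Ioo.preimage Complex.continuous_im

theorem ofReal_mem_strip (hν : 0 < ν) (x : ℝ) : (x : ℂ) ∈ strip ν := by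
  have : 0 < 1 / ν := one_div_pos.mpr hν
  simpa [strip] using this

theorem DecaySpace.norm_le (i : SeminormIndex ν) (F : DecaySpace δ ν) {z : ℂ} (hz : z.im ∈ i.1.1) :
    ‖F.1 z‖ ≤ decaySeminorm δ ν i F * Real.exp (-(δ - i.2.1) * |z.re|) := by
  have h : Real.exp ((δ - i.2.1) * |z.re|) * ‖F.1 z‖ ≤ decaySeminorm δ ν i F :=
    le_ciSup (bddAbove_weighted i F) (⟨z, hz⟩ : {z : ℂ // z.im ∈ i.1.1})
  rw [neg_mul, Real.exp_neg, ← div_eq_mul_inv, le_div_iff₀ (Real.exp_pos _), mul_comm]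
  exact h

theorem decaySeminorm_le (i : SeminormIndex ν) (F : DecaySpace δ ν) {C : ℝ} (hC : 0 ≤ C)
    (h : ∀ z : ℂ, z.im ∈ i.1.1 → ‖F.1 z‖ ≤ C * Real.exp (-(δ - i.2.1) * |z.re|)) :
    decaySeminorm δ ν i F ≤ C := by
  refine Real.iSup_le (fun z => ?_) hC
  have := h z.1 z.2
  rw [neg_mul, Real.exp_neg, ← div_eq_mul_inv, le_div_iff₀ (Real.exp_pos _), mul_comm] at this
  exact this

theorem differentiableOn_iteratedDeriv {U : Set ℂ} (hU : IsOpen U) {F : ℂ → ℂ}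
    (hF : DifferentiableOn ℂ F U) (k : ℕ) : DifferentiableOn ℂ (iteratedDeriv k F) U := by
  induction k with
  | zero => simpa using hF
  | succ k ih => rw [iteratedDeriv_succ]; exact ih.deriv hU

/-- Cauchy's estimates in a step space. -/
theorem DecaySpace.norm_iteratedDeriv_le {i i' : SeminormIndex ν} (hε : i'.2 = i.2) {r : ℝ}
    (hr : 0 < r) (hi : Metric.cthickening r i.1.1 ⊆ i'.1.1) (F : DecaySpace δ ν) (k : ℕ) {z : ℂ}
    (hz : z.im ∈ i.1.1) :
    ‖iteratedDeriv k F.1 z‖ ≤ k.factorial / r ^ k *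
      (Real.exp (|δ - i.2.1| * r) * decaySeminorm δ ν i' F * Real.exp (-(δ - i.2.1) * |z.re|)) := by
  have him : ∀ w : ℂ, dist w z ≤ r → w.im ∈ i'.1.1 := fun w hw => by
    refine hi (Metric.mem_cthickening_of_dist_le _ _ _ _ hz ?_)
    refine le_trans ?_ hw
    rw [Real.dist_eq, dist_eq_norm, ← Complex.sub_im]
    exact Complex.abs_im_le_norm _
  have hd : DiffContOnCl ℂ F.1 (Metric.ball z r) := by
    refine DifferentiableOn.diffContOnCl (F.2.1.mono fun w hw => ?_)
    rw [closure_ball z hr.ne'] at hw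
    exact i'.1.2.2 (him w hw)
  refine (Complex.norm_iteratedDeriv_le_of_forall_mem_sphere_norm_le k hr hd
    (C := Real.exp (|δ - i.2.1| * r) * decaySeminorm δ ν i' F * Real.exp (-(δ - i.2.1) * |z.re|))
    fun w hw => ?_).trans_eq (by ring)
  have hw' : dist w z ≤ r := (Metric.mem_sphere.mp hw).le
  refine (F.norm_le i' (him w hw')).trans ?_
  have h0 : 0 ≤ decaySeminorm δ ν i' F := apply_nonneg _ _
  rw [mul_comm (Real.exp _) (decaySeminorm δ ν i' F), mul_assoc, ← Real.exp_add, hε]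
  refine mul_le_mul_of_nonneg_left (Real.exp_le_exp.mpr ?_) h0
  -- Moving from `z` to the circle changes the weight by at most `exp (|δ - ε| r)`. The absolute
  -- value is needed because `δ - ε` may be negative.
  have h1 : |(|z.re| - |w.re|)| ≤ r := by
    refine (abs_abs_sub_abs_le _ _).trans ?_
    rw [← Complex.sub_re]
    refine (Complex.abs_re_le_norm _).trans ?_
    rwa [← dist_eq_norm, dist_comm]
  have h2 : (δ - i.2.1) * (|z.re| - |w.re|) ≤ |δ - i.2.1| * r := by
    refine (le_abs_self _).trans ?_
    rw [abs_mul]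
    exact mul_le_mul_of_nonneg_left h1 (abs_nonneg _)
  linarith

/-- Every seminorm index can be enlarged by a neighbourhood of its compact set. -/
theorem exists_seminormIndex_cthickening (i : SeminormIndex ν) :
    ∃ r : ℝ, 0 < r ∧ ∃ i' : SeminormIndex ν, i'.2 = i.2 ∧ Metric.cthickening r i.1.1 ⊆ i'.1.1 := by
  obtain ⟨r, hr, h⟩ := i.1.2.1.exists_cthickening_subset_open isOpen_Ioo i.1.2.2
  exact ⟨r, hr, ⟨⟨Metric.cthickening r i.1.1, i.1.2.1.cthickening, h⟩, i.2⟩, rfl, subset_rfl⟩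

/-- The condition on `(a_k)` under which `∑ a_k d^k/dz^k` acts locally on holomorphic functions. -/
def IsLocalSymbol (a : ℕ → ℂ) : Prop :=
  ∀ r : ℝ, 0 < r → Summable fun k : ℕ => ‖a k‖ * (k.factorial / r ^ k)

variable {a : ℕ → ℂ}

theorem norm_mul_iteratedDeriv_le {i i' : SeminormIndex ν} (hε : i'.2 = i.2) {r : ℝ}
    (hr : 0 < r) (hi : Metric.cthickening r i.1.1 ⊆ i'.1.1) (F : DecaySpace δ ν) (k : ℕ) {z : ℂ}
    (hz : z.im ∈ i.1.1) :
    ‖a k * iteratedDeriv k F.1 z‖ ≤ ‖a k‖ * (k.factorial / r ^ k) *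
      (Real.exp (|δ - i.2.1| * r) * decaySeminorm δ ν i' F * Real.exp (-(δ - i.2.1) * |z.re|)) := by
  rw [norm_mul, mul_assoc]
  exact mul_le_mul_of_nonneg_left (F.norm_iteratedDeriv_le hε hr hi k hz) (norm_nonneg _)

/-- The index consisting of a point `y ∈ I_ν` and an arbitrary `ε`. -/
def singletonIndex {y : ℝ} (hy : y ∈ Ioo (-(1 / ν)) (1 / ν)) {ε : ℝ} (hε : 0 < ε) :
    SeminormIndex ν :=
  ⟨⟨{y}, isCompact_singleton, singleton_subset_iff.mpr hy⟩, ⟨ε, hε⟩⟩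

theorem summable_norm_mul_iteratedDeriv (ha : IsLocalSymbol a) (F : DecaySpace δ ν) {z : ℂ}
    (hz : z ∈ strip ν) : Summable fun k => ‖a k * iteratedDeriv k F.1 z‖ := by
  obtain ⟨r, hr, i', hε, hi⟩ :=
    exists_seminormIndex_cthickening (singletonIndex (ν := ν) hz one_pos)
  exact Summable.of_nonneg_of_le (fun k => norm_nonneg _)
    (fun k => norm_mul_iteratedDeriv_le hε hr hi F k (mem_singleton _)) ((ha r hr).mul_right _)

/-- The function `∑ a_k F^(k)` on the strip, extended by zero. -/
def seriesApply (a : ℕ → ℂ) (ν : ℝ) (F : ℂ → ℂ) : ℂ → ℂ :=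
  (strip ν).indicator fun z => ∑' k, a k * iteratedDeriv k F z

/-- This single estimate yields both the decay of the image and the continuity of the operator: `ε`
is unchanged and only the compact set grows. -/
theorem norm_seriesApply_le (ha : IsLocalSymbol a) {i i' : SeminormIndex ν} (hε : i'.2 = i.2)
    {r : ℝ} (hr : 0 < r) (hi : Metric.cthickening r i.1.1 ⊆ i'.1.1) (F : DecaySpace δ ν) {z : ℂ}
    (hz : z.im ∈ i.1.1) :
    ‖seriesApply a ν F.1 z‖ ≤ (∑' k : ℕ, ‖a k‖ * (k.factorial / r ^ k)) *
      (Real.exp (|δ - i.2.1| * r) * decaySeminorm δ ν i' F * Real.exp (-(δ - i.2.1) * |z.re|)) := by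
  rw [seriesApply, indicator_of_mem (show z ∈ strip ν from i.1.2.2 hz), ← tsum_mul_right]
  exact tsum_of_norm_bounded ((ha r hr).mul_right _).hasSum
    fun k => norm_mul_iteratedDeriv_le hε hr hi F k hz

theorem differentiableOn_seriesApply (ha : IsLocalSymbol a) (hδ : 0 < δ) (F : DecaySpace δ ν) :
    DifferentiableOn ℂ (seriesApply a ν F.1) (strip ν) := by
  refine DifferentiableOn.congr (f := fun z => ∑' k, a k * iteratedDeriv k F.1 z) ?_
    fun z hz => indicator_of_mem hz _
  intro z hz
  obtain ⟨s, hs, h1⟩ := (isCompact_singleton (x := z.im)).exists_cthickening_subset_open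
    isOpen_Ioo (singleton_subset_iff.mpr hz)
  -- With `ε = δ` the weight is constantly `1`, which leaves a bound uniform on the ball.
  let i : SeminormIndex ν := ⟨⟨_, isCompact_singleton.cthickening, h1⟩, ⟨δ, hδ⟩⟩
  obtain ⟨r, hr, i', hε, hi⟩ := exists_seminormIndex_cthickening i
  have hmem : ∀ w ∈ Metric.ball z s, w.im ∈ i.1.1 := fun w hw => by
    refine Metric.mem_cthickening_of_dist_le _ _ _ _ (mem_singleton _) ?_
    rw [Real.dist_eq, ← Complex.sub_im]
    exact (Complex.abs_im_le_norm _).trans (mem_ball_iff_norm.mp hw).le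
  have hd : DifferentiableOn ℂ (fun z => ∑' k, a k * iteratedDeriv k F.1 z) (Metric.ball z s) := by
    refine Complex.differentiableOn_tsum_of_summable_norm ((ha r hr).mul_right
      (decaySeminorm δ ν i' F)) (fun k => ?_) Metric.isOpen_ball fun k w hw =>
        (norm_mul_iteratedDeriv_le hε hr hi F k (hmem w hw)).trans_eq ?_
    · refine ((differentiableOn_iteratedDeriv (isOpen_strip ν) F.2.1 k).mono fun w hw => ?_).const_mul _
      exact i.1.2.2 (hmem w hw)
    · simp [i]
  exact (hd.differentiableAt (Metric.ball_mem_nhds z hs)).differentiableWithinAt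

/-- `∑ a_k d^k/dz^k` on a step space. -/
def seriesOperator (ha : IsLocalSymbol a) (hδ : 0 < δ) : DecaySpace δ ν →ₗ[ℂ] DecaySpace δ ν where
  toFun F := ⟨seriesApply a ν F.1, differentiableOn_seriesApply ha hδ F,
    fun z hz => indicator_of_notMem hz _, fun K hK hKs ε hε => by
      let i : SeminormIndex ν := ⟨⟨K, hK, hKs⟩, ⟨ε, hε⟩⟩
      obtain ⟨r, hr, i', hε', hi⟩ := exists_seminormIndex_cthickening i
      refine ⟨(∑' k : ℕ, ‖a k‖ * (k.factorial / r ^ k)) *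
        (Real.exp (|δ - ε| * r) * decaySeminorm δ ν i' F), fun z hz => ?_⟩
      exact (norm_seriesApply_le ha hε' hr hi F (z := z) hz).trans_eq (by simp only [i, mul_assoc])⟩
  map_add' F G := by
    refine Subtype.ext (funext fun z => ?_)
    change seriesApply a ν (F.1 + G.1) z = seriesApply a ν F.1 z + seriesApply a ν G.1 z
    by_cases hz : z ∈ strip ν
    · simp only [seriesApply, indicator_of_mem hz]
      rw [← (summable_norm_mul_iteratedDeriv ha F hz).of_norm.tsum_add
        (summable_norm_mul_iteratedDeriv ha G hz).of_norm]
      refine tsum_congr fun k => ?_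
      have hn := (isOpen_strip ν).mem_nhds hz
      rw [iteratedDeriv_add ((F.2.1.contDiffOn (isOpen_strip ν)).contDiffAt hn)
        ((G.2.1.contDiffOn (isOpen_strip ν)).contDiffAt hn), mul_add]
    · simp [seriesApply, indicator_of_notMem hz]
  map_smul' c F := by
    refine Subtype.ext (funext fun z => ?_)
    change seriesApply a ν (c • F.1) z = c • seriesApply a ν F.1 z
    by_cases hz : z ∈ strip ν
    · simp only [seriesApply, indicator_of_mem hz, smul_eq_mul]
      rw [← tsum_mul_left]
      refine tsum_congr fun k => ?_
      have hn := (isOpen_strip ν).mem_nhds hz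
      rw [iteratedDeriv_const_smul ((F.2.1.contDiffOn (isOpen_strip ν)).contDiffAt hn),
        smul_eq_mul, mul_left_comm]
    · simp [seriesApply, indicator_of_notMem hz]

theorem withSeminorms_decaySeminorm (δ ν : ℝ) : WithSeminorms (decaySeminorm δ ν) := ⟨rfl⟩

theorem continuous_seriesOperator (ha : IsLocalSymbol a) (hδ : 0 < δ) :
    Continuous (seriesOperator (ν := ν) ha hδ) := by
  refine WithSeminorms.continuous_of_isBounded (withSeminorms_decaySeminorm δ ν)
    (withSeminorms_decaySeminorm δ ν) _ fun i => ?_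
  obtain ⟨r, hr, i', hε, hi⟩ := exists_seminormIndex_cthickening i
  have hsum : 0 ≤ ∑' k : ℕ, ‖a k‖ * (k.factorial / r ^ k) := tsum_nonneg fun k => by positivity
  refine ⟨{i'}, ⟨(∑' k : ℕ, ‖a k‖ * (k.factorial / r ^ k)) * Real.exp (|δ - i.2.1| * r),
    by positivity⟩, fun F => ?_⟩
  have h0 : 0 ≤ decaySeminorm δ ν i' F := apply_nonneg _ _
  rw [Finset.sup_singleton]
  change decaySeminorm δ ν i (seriesOperator ha hδ F) ≤
    (∑' k : ℕ, ‖a k‖ * (k.factorial / r ^ k)) * Real.exp (|δ - i.2.1| * r) * decaySeminorm δ ν i' F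
  refine decaySeminorm_le i _ (by positivity) fun z hz => ?_
  refine (norm_seriesApply_le ha hε hr hi F hz).trans_eq ?_
  simp only [mul_assoc]

/-! ### The operator on `𝒫_*(𝔻)` -/

theorem iteratedDeriv_comp_ofReal {U : Set ℂ} (hU : IsOpen U) {F : ℂ → ℂ}
    (hF : DifferentiableOn ℂ F U) (hreal : ∀ x : ℝ, (x : ℂ) ∈ U) (k : ℕ) :
    iteratedDeriv k (fun x : ℝ => F x) = fun x : ℝ => iteratedDeriv k F x := by
  induction k with
  | zero => simp
  | succ k ih =>
    rw [iteratedDeriv_succ, ih, iteratedDeriv_succ]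
    ext x
    exact (((differentiableOn_iteratedDeriv hU hF k).differentiableAt
      (hU.mem_nhds (hreal x))).hasDerivAt.comp_ofReal).deriv

theorem PStar.exists_ofStep (φ : PStar) :
    ∃ (n : ℕ+) (F : DecaySpace (1 / (n : ℝ)) n), ofStep n F = φ := by
  obtain ⟨f, n, F, hF, h⟩ := φ
  exact ⟨n, ⟨F, hF⟩, Subtype.ext (funext fun x => (h x).symm)⟩

theorem one_div_pnat_pos (n : ℕ+) : (0 : ℝ) < 1 / (n : ℝ) :=
  one_div_pos.mpr (by exact_mod_cast n.pos)

theorem ofReal_mem_strip_pnat (n : ℕ+) (x : ℝ) : (x : ℂ) ∈ strip (n : ℝ) :=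
  ofReal_mem_strip (by exact_mod_cast n.pos) x

theorem iteratedDeriv_ofStep {n : ℕ+} (F : DecaySpace (1 / (n : ℝ)) n) (k : ℕ) :
    iteratedDeriv k (ofStep n F).1 = fun x : ℝ => iteratedDeriv k F.1 x :=
  iteratedDeriv_comp_ofReal (isOpen_strip n) F.2.1 (ofReal_mem_strip_pnat n) k

theorem contDiff_pStar (φ : PStar) : ContDiff ℝ ((⊤ : ℕ∞) : WithTop ℕ∞) φ.1 := by
  obtain ⟨n, F, rfl⟩ := φ.exists_ofStep
  refine contDiff_of_differentiable_iteratedDeriv fun k _ x => ?_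
  rw [iteratedDeriv_ofStep]
  exact (((differentiableOn_iteratedDeriv (isOpen_strip n) F.2.1 k).differentiableAt
      ((isOpen_strip n).mem_nhds (ofReal_mem_strip_pnat n x))).hasDerivAt.comp_ofReal).differentiableAt

theorem contDiffAt_pStar (φ : PStar) (k : ℕ) (x : ℝ) : ContDiffAt ℝ k φ.1 x :=
  ((contDiff_pStar φ).of_le (by exact_mod_cast le_top)).contDiffAt

theorem hasSum_seriesOperator (ha : IsLocalSymbol a) {n : ℕ+} (F : DecaySpace (1 / (n : ℝ)) n)
    (t : ℝ) : HasSum (fun k => a k * iteratedDeriv k (ofStep n F).1 t)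
      ((ofStep n (seriesOperator ha (one_div_pnat_pos n) F)).1 t) := by
  have ht := ofReal_mem_strip_pnat n t
  have h : (ofStep n (seriesOperator ha (one_div_pnat_pos n) F)).1 t =
      ∑' k, a k * iteratedDeriv k (ofStep n F).1 t := by
    change seriesApply a n F.1 t = _
    rw [seriesApply, indicator_of_mem ht]
    simp only [iteratedDeriv_ofStep]
  rw [h]
  refine Summable.hasSum ?_
  simp only [iteratedDeriv_ofStep]
  exact (summable_norm_mul_iteratedDeriv ha F ht).of_norm

/-- `∑ a_k d^k/dt^k` on `𝒫_*(𝔻)`. -/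
def pStarOperatorFun (ha : IsLocalSymbol a) (φ : PStar) : PStar :=
  ofStep φ.exists_ofStep.choose (seriesOperator ha (one_div_pnat_pos _)
    φ.exists_ofStep.choose_spec.choose)

/-- The value at `t` is the sum of a series in `φ` alone, so the chosen step and extension do not
matter. Linearity and compatibility with `ofStep` then follow from uniqueness of sums. -/
theorem hasSum_pStarOperatorFun (ha : IsLocalSymbol a) (φ : PStar) (t : ℝ) :
    HasSum (fun k => a k * iteratedDeriv k φ.1 t) ((pStarOperatorFun ha φ).1 t) := by
  have h := hasSum_seriesOperator ha φ.exists_ofStep.choose_spec.choose t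
  rwa [φ.exists_ofStep.choose_spec.choose_spec] at h

/-- `∑ a_k d^k/dt^k` on `𝒫_*(𝔻)`, as a linear map. -/
def pStarOperator (ha : IsLocalSymbol a) : PStar →ₗ[ℂ] PStar where
  toFun := pStarOperatorFun ha
  map_add' φ ψ := by
    refine Subtype.ext (funext fun t => ?_)
    refine (hasSum_pStarOperatorFun ha (φ + ψ) t).unique
      (((hasSum_pStarOperatorFun ha φ t).add (hasSum_pStarOperatorFun ha ψ t)).congr_fun fun k => ?_)
    change a k * iteratedDeriv k (φ.1 + ψ.1) t = _
    rw [iteratedDeriv_add (contDiffAt_pStar φ k t) (contDiffAt_pStar ψ k t), mul_add]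
  map_smul' c φ := by
    refine Subtype.ext (funext fun t => ?_)
    refine (hasSum_pStarOperatorFun ha (c • φ) t).unique
      (((hasSum_pStarOperatorFun ha φ t).mul_left c).congr_fun fun k => ?_)
    change a k * iteratedDeriv k (c • φ.1) t = _
    rw [iteratedDeriv_const_smul (contDiffAt_pStar φ k t), smul_eq_mul, mul_left_comm]

theorem pStarOperator_ofStep (ha : IsLocalSymbol a) {n : ℕ+} (F : DecaySpace (1 / (n : ℝ)) n) :
    pStarOperator ha (ofStep n F) = ofStep n (seriesOperator ha (one_div_pnat_pos n) F) :=
  Subtype.ext (funext fun t =>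
    (hasSum_pStarOperatorFun ha (ofStep n F) t).unique (hasSum_seriesOperator ha F t))

/-! ### The inductive limit topology -/

theorem continuous_ofStep (n : ℕ+) : Continuous (ofStep n) :=
  continuous_sInf_rng.mpr fun _ ht => ht.1 n

instance : IsTopologicalAddGroup PStar := topologicalAddGroup_sInf fun _ ht => ht.2.1

instance : ContinuousSMul ℂ PStar := continuousSMul_sInf fun _ ht => ht.2.2.1

instance : LocallyConvexSpace ℝ PStar := LocallyConvexSpace.sInf fun _ ht => ht.2.2.2

instance : IsScalarTower ℝ ℂ PStar := inferInstanceAs (IsScalarTower ℝ ℂ ↥pStarSubmodule)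

/-- The universal property of the inductive limit, for endomorphisms. -/
theorem continuous_of_forall_comp_ofStep (T : PStar →ₗ[ℂ] PStar)
    (hT : ∀ n : ℕ+, Continuous fun F => T (ofStep n F)) : Continuous T := by
  -- The topology induced by `T` is itself one of the topologies whose infimum defines that of
  -- `PStar`.
  rw [continuous_iff_le_induced]
  refine sInf_le ⟨fun n => continuous_induced_rng.mpr (hT n), topologicalAddGroup_induced T,
    continuousSMul_induced T, ?_⟩
  exact LocallyConvexSpace.induced (T.restrictScalars ℝ)

theorem continuous_pStarOperator (ha : IsLocalSymbol a) : Continuous (pStarOperator ha) := by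
  refine continuous_of_forall_comp_ofStep _ fun n => ?_
  simp only [pStarOperator_ofStep]
  exact (continuous_ofStep n).comp (continuous_seriesOperator ha (one_div_pnat_pos n))

/-! ### Probability measures whose characteristic function is a limit -/

/-- Continuity of the limit at `0` forces tightness, and Prokhorov's theorem supplies a limit point;
the moment bound passes to it as in Fatou's lemma. -/
theorem exists_charFun_eq_of_tendsto (ν : ℕ → Measure ℝ) [∀ n, IsProbabilityMeasure (ν n)]
    {f : ℝ → ℂ} (hf : ContinuousAt f 0)
    (h : ∀ t, Tendsto (fun n => charFun (ν n) t) atTop (𝓝 (f t)))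
    {g : ℝ → ℝ≥0} (hg : Continuous g) {C : ℝ≥0∞} (hC : ∀ n, ∫⁻ x, g x ∂ν n ≤ C) :
    ∃ μ : Measure ℝ, IsProbabilityMeasure μ ∧ (∀ t, charFun μ t = f t) ∧ ∫⁻ x, g x ∂μ ≤ C := by
  let P : ℕ → ProbabilityMeasure ℝ := fun n => ⟨ν n, inferInstance⟩
  have htight : IsTightMeasureSet {((μ : ProbabilityMeasure ℝ) : Measure ℝ) | μ ∈ range P} := by
    refine (isTightMeasureSet_of_tendsto_charFun hf h).subset ?_
    rintro _ ⟨_, ⟨n, rfl⟩, rfl⟩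
    exact ⟨n, rfl⟩
  -- A limit along an ultrafilter finer than `atTop` replaces the extraction of a subsequence.
  obtain ⟨μ, -, hμ⟩ := (isCompact_closure_of_isTightMeasureSet htight).ultrafilter_le_nhds
    ((Ultrafilter.of atTop).map P) (le_principal_iff.mpr
      (mem_map.mpr (univ_mem' fun n => subset_closure (mem_range_self n))))
  have hlim : Tendsto P ↑(Ultrafilter.of (atTop : Filter ℕ)) (𝓝 μ) := hμ
  refine ⟨μ, inferInstance, fun t => ?_, ?_⟩
  · refine tendsto_nhds_unique ?_ ((h t).mono_left (Ultrafilter.of_le atTop))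
    rw [ProbabilityMeasure.tendsto_iff_forall_integral_rclike_tendsto ℂ] at hlim
    simp_rw [charFun_eq_integral_innerProbChar]
    exact hlim _
  -- Weak convergence tests only bounded functions, so `g` is truncated at `M` and recovered by
  -- monotone convergence.
  · have hmin : ∀ M : ℕ, ∫⁻ x, (min (g x) M : ℝ≥0) ∂(μ : Measure ℝ) ≤ C := by
      intro M
      rw [ProbabilityMeasure.tendsto_iff_forall_lintegral_tendsto] at hlim
      let gM : BoundedContinuousFunction ℝ ℝ≥0 :=
        BoundedContinuousFunction.mkOfBound ⟨fun x => min (g x) M, by fun_prop⟩ M fun x y => by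
          rw [NNReal.dist_eq, abs_sub_le_iff]
          have hx : ((min (g x) M : ℝ≥0) : ℝ) ≤ M := by exact_mod_cast min_le_right _ _
          have hy : ((min (g y) M : ℝ≥0) : ℝ) ≤ M := by exact_mod_cast min_le_right _ _
          have hx0 := (min (g x) M : ℝ≥0).coe_nonneg
          have hy0 := (min (g y) M : ℝ≥0).coe_nonneg
          constructor <;> simp only [ContinuousMap.coe_mk] <;> linarith
      refine le_of_tendsto (hlim gM) (.of_forall fun n => le_trans ?_ (hC n))
      exact lintegral_mono fun x => ENNReal.coe_le_coe.mpr (min_le_left _ _)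
    have hsup : ∀ x, (g x : ℝ≥0∞) = ⨆ M : ℕ, ((min (g x) M : ℝ≥0) : ℝ≥0∞) := by
      intro x
      refine le_antisymm ?_ (iSup_le fun M => ENNReal.coe_le_coe.mpr (min_le_left _ _))
      obtain ⟨M, hM⟩ := exists_nat_ge (g x)
      exact le_iSup_of_le M (by rw [min_eq_left hM])
    simp_rw [hsup]
    rw [lintegral_iSup (fun M => by fun_prop) fun M N hMN x => by
      have : (M : ℝ≥0) ≤ N := by exact_mod_cast hMN
      exact ENNReal.coe_le_coe.mpr (min_le_min_left _ this)]
    exact iSup_le hmin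

/-! ### Laplace distributions -/

theorem integrableOn_Ioi_exp_neg_abs {c : ℂ} (hc : |c.re| < 1) :
    IntegrableOn (fun x : ℝ => (Real.exp (-|x|) : ℂ) * Complex.exp (c * x)) (Ioi 0) ∧
      ∫ x in Ioi (0 : ℝ), (Real.exp (-|x|) : ℂ) * Complex.exp (c * x) = 1 / (1 - c) := by
  have hre : (c - 1).re < 0 := by
    have := (abs_lt.mp hc).2
    simpa using this
  have heq : EqOn (fun x : ℝ => (Real.exp (-|x|) : ℂ) * Complex.exp (c * x))
      (fun x : ℝ => Complex.exp ((c - 1) * x)) (Ioi 0) := fun x hx => by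
    simp only [abs_of_pos (mem_Ioi.mp hx)]
    rw [Complex.ofReal_exp, ← Complex.exp_add]
    push_cast
    ring_nf
  refine ⟨(integrableOn_exp_mul_complex_Ioi hre 0).congr_fun heq.symm measurableSet_Ioi, ?_⟩
  rw [setIntegral_congr_fun measurableSet_Ioi heq, integral_exp_mul_complex_Ioi hre]
  have h1 : c - 1 ≠ 0 := fun h => by rw [h] at hre; simp at hre
  have h2 : 1 - c ≠ 0 := fun h => h1 (by rw [← neg_sub, h, neg_zero])
  simp only [Complex.ofReal_zero, mul_zero, Complex.exp_zero]
  rw [← neg_sub 1 c]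
  field_simp

theorem integral_exp_neg_abs_mul_exp {c : ℂ} (hc : |c.re| < 1) :
    Integrable (fun x : ℝ => (Real.exp (-|x|) : ℂ) * Complex.exp (c * x)) ∧
      ∫ x : ℝ, (Real.exp (-|x|) : ℂ) * Complex.exp (c * x) = 2 / (1 - c ^ 2) := by
  obtain ⟨i1, e1⟩ := integrableOn_Ioi_exp_neg_abs hc
  obtain ⟨i2, e2⟩ := integrableOn_Ioi_exp_neg_abs (c := -c) (by simpa using hc)
  have hneg : ∀ x : ℝ, (Real.exp (-|(-x)|) : ℂ) * Complex.exp (c * ((-x : ℝ) : ℂ)) =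
      (Real.exp (-|x|) : ℂ) * Complex.exp (-c * x) := fun x => by
    rw [abs_neg]; push_cast; ring_nf
  have i3 : IntegrableOn (fun x : ℝ => (Real.exp (-|x|) : ℂ) * Complex.exp (c * x)) (Iic 0) := by
    rw [← integrableOn_Ici_iff_integrableOn_Ioi] at i2
    have := i2.comp_neg
    simp only [neg_Ici, neg_zero] at this
    refine this.congr_fun (fun x _ => ?_) measurableSet_Iic
    simp
  have e3 : ∫ x in Iic (0 : ℝ), (Real.exp (-|x|) : ℂ) * Complex.exp (c * x) = 1 / (1 + c) := by
    have := integral_comp_neg_Ioi (0 : ℝ)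
      (fun x : ℝ => (Real.exp (-|x|) : ℂ) * Complex.exp (c * x))
    rw [neg_zero] at this
    rw [← this]
    simp only [hneg]
    rw [e2, sub_neg_eq_add]
  refine ⟨?_, ?_⟩
  · rw [← integrableOn_univ, ← Iic_union_Ioi (a := (0 : ℝ))]
    exact i3.union i1
  · rw [← intervalIntegral.integral_Iic_add_Ioi i3 i1, e1, e3]
    have h1 : 1 - c ≠ 0 := fun h => by
      have : c.re = 1 := by rw [← sub_eq_zero.mp h]; simp
      rw [this] at hc; simp at hc
    have h2 : 1 + c ≠ 0 := fun h => by
      have : c.re = -1 := by rw [eq_neg_of_add_eq_zero_right h]; simp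
      rw [this] at hc; simp at hc
    have h3 : 1 - c ^ 2 ≠ 0 := by
      have : 1 - c ^ 2 = (1 - c) * (1 + c) := by ring
      rw [this]; exact mul_ne_zero h1 h2
    field_simp
    ring

/-- The standard Laplace distribution, of density `exp (-|x|) / 2`. -/
def standardLaplace : Measure ℝ :=
  volume.withDensity fun x => ENNReal.ofReal (Real.exp (-|x|) / 2)

/-- Imaginary `c` gives the characteristic function `1/(1 + t²)`; real `c` gives the exponential
moments. -/
theorem integral_standardLaplace {c : ℂ} (hc : |c.re| < 1) :
    ∫ x, Complex.exp (c * x) ∂standardLaplace = 1 / (1 - c ^ 2) := by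
  rw [standardLaplace, integral_withDensity_eq_integral_toReal_smul (by fun_prop) (by simp)]
  have : ∀ x : ℝ, (ENNReal.ofReal (Real.exp (-|x|) / 2)).toReal • Complex.exp (c * x) =
      (1 / 2 : ℂ) * ((Real.exp (-|x|) : ℂ) * Complex.exp (c * x)) := fun x => by
    rw [ENNReal.toReal_ofReal (by positivity), Complex.real_smul]
    push_cast; ring
  simp only [this]
  rw [integral_const_mul, (integral_exp_neg_abs_mul_exp hc).2]
  ring

theorem lintegral_standardLaplace {η : ℝ} (hη : |η| < 1) :
    ∫⁻ x, ENNReal.ofReal (Real.exp (η * x)) ∂standardLaplace = ENNReal.ofReal (1 / (1 - η ^ 2)) := by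
  obtain ⟨hi, he⟩ := integral_exp_neg_abs_mul_exp (c := η) (by simpa using hη)
  have hreal : ∀ x : ℝ, (Real.exp (-|x|) : ℂ) * Complex.exp (η * x) =
      ((Real.exp (-|x|) * Real.exp (η * x) : ℝ) : ℂ) := fun x => by push_cast; rfl
  simp only [hreal] at hi he
  rw [integral_complex_ofReal] at he
  have he' : ∫ x : ℝ, Real.exp (-|x|) * Real.exp (η * x) = 2 / (1 - η ^ 2) := by
    exact_mod_cast he
  have hi' : Integrable fun x : ℝ => Real.exp (-|x|) * Real.exp (η * x) := by
    simpa only [RCLike.re_eq_complex_re, Complex.ofReal_re] using hi.re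
  rw [standardLaplace, lintegral_withDensity_eq_lintegral_mul _ (by fun_prop) (by fun_prop)]
  have : ∀ x : ℝ, ((fun x => ENNReal.ofReal (Real.exp (-|x|) / 2)) *
      fun x => ENNReal.ofReal (Real.exp (η * x))) x =
      ENNReal.ofReal (1 / 2 * (Real.exp (-|x|) * Real.exp (η * x))) := fun x => by
    rw [Pi.mul_apply, ← ENNReal.ofReal_mul (by positivity)]
    ring_nf
  simp only [this]
  rw [← ofReal_integral_eq_lintegral_ofReal (hi'.const_mul _)
    (.of_forall fun x => by positivity), integral_const_mul, he']
  congr 1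
  ring

instance : IsProbabilityMeasure standardLaplace := by
  constructor
  have := lintegral_standardLaplace (η := 0) (by simp)
  simpa using this

/-- The law of `∑_{i < n} a_i X_i`, for independent standard Laplace variables `X_i`. -/
def laplaceSum (a : ℕ → ℝ) : ℕ → Measure ℝ
  | 0 => Measure.dirac 0
  | n + 1 => (laplaceSum a n).conv (standardLaplace.map (a n * ·))

instance isProbabilityMeasure_map_standardLaplace (b : ℝ) :
    IsProbabilityMeasure (standardLaplace.map (b * ·)) :=
  Measure.isProbabilityMeasure_map (by fun_prop)

instance isProbabilityMeasure_laplaceSum (a : ℕ → ℝ) (n : ℕ) :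
    IsProbabilityMeasure (laplaceSum a n) := by
  induction n with
  | zero => rw [laplaceSum]; infer_instance
  | succ n ih => rw [laplaceSum]; infer_instance

theorem charFun_laplaceSum (a : ℕ → ℝ) (n : ℕ) (t : ℝ) :
    charFun (laplaceSum a n) t = ∏ i ∈ Finset.range n, (1 / (1 + (a i ^ 2 : ℝ) * (t : ℂ) ^ 2)) := by
  induction n with
  | zero => simp [laplaceSum]
  | succ n ih =>
    rw [laplaceSum, charFun_conv, ih, Finset.prod_range_succ]
    congr 1
    rw [charFun_apply_real, integral_map (by fun_prop) (by fun_prop)]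
    have h := integral_standardLaplace (c := t * a n * Complex.I) (by simp)
    have e : ∀ x : ℝ, (t : ℂ) * ((a n * x : ℝ) : ℂ) * Complex.I = t * a n * Complex.I * x :=
      fun x => by push_cast; ring
    simp only [e, h]
    rw [mul_pow, Complex.I_sq]
    push_cast
    ring_nf

/-- The moment of a convolution is a product of factors `1/(1 - u)` with `u = (η a_i)² ≤ 1/2`, and
`1/(1 - u) ≤ 1 + 2u ≤ exp (2u)`. The resulting bound is independent of `n`. -/
theorem lintegral_exp_laplaceSum_le (a : ℕ → ℝ) (ha : Summable fun i => a i ^ 2) {η : ℝ}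
    (hη : ∀ i, (η * a i) ^ 2 ≤ 1 / 2) (n : ℕ) :
    ∫⁻ x, ENNReal.ofReal (Real.exp (η * x)) ∂laplaceSum a n ≤
      ENNReal.ofReal (Real.exp (2 * η ^ 2 * ∑' i, a i ^ 2)) := by
  have key : ∫⁻ x, ENNReal.ofReal (Real.exp (η * x)) ∂laplaceSum a n ≤
      ENNReal.ofReal (Real.exp (2 * η ^ 2 * ∑ i ∈ Finset.range n, a i ^ 2)) := by
    induction n with
    | zero => simp [laplaceSum]
    | succ n ih =>
      rw [laplaceSum, Measure.lintegral_conv (by fun_prop)]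
      simp only [mul_add, Real.exp_add, ENNReal.ofReal_mul (Real.exp_pos _).le]
      have hlt : |η * a n| < 1 := by
        rw [← sq_lt_one_iff_abs_lt_one]
        linarith [hη n]
      have hfac : ∫⁻ y, ENNReal.ofReal (Real.exp (η * y)) ∂(standardLaplace.map (a n * ·)) ≤
          ENNReal.ofReal (Real.exp (2 * η ^ 2 * a n ^ 2)) := by
        rw [lintegral_map (by fun_prop) (by fun_prop)]
        simp only [← mul_assoc]
        rw [lintegral_standardLaplace hlt]
        refine ENNReal.ofReal_le_ofReal ?_
        have h1 : 1 / (1 - (η * a n) ^ 2) ≤ 1 + 2 * (η * a n) ^ 2 := by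
          rw [div_le_iff₀ (by linarith [hη n])]
          nlinarith [hη n, sq_nonneg (η * a n)]
        refine h1.trans ?_
        have := Real.add_one_le_exp (2 * η ^ 2 * a n ^ 2)
        nlinarith
      simp only [lintegral_const_mul _ (show Measurable fun y : ℝ => ENNReal.ofReal (Real.exp (η * y))
        by fun_prop)]
      rw [lintegral_mul_const _ (by fun_prop), Finset.sum_range_succ, mul_add, Real.exp_add,
        ENNReal.ofReal_mul (Real.exp_pos _).le]
      exact mul_le_mul' ih hfac
  refine key.trans (ENNReal.ofReal_le_ofReal (Real.exp_le_exp.mpr ?_))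
  exact mul_le_mul_of_nonneg_left (ha.sum_le_tsum _ fun i _ => sq_nonneg _) (by positivity)

/-- The law of `∑ a_i X_i`, for independent standard Laplace variables `X_i`. -/
theorem exists_measure_charFun_eq (a : ℕ → ℝ) (ha : Summable fun i => a i ^ 2) {η : ℝ}
    (hη : ∀ i, (η * a i) ^ 2 ≤ 1 / 2) {f : ℝ → ℂ} (hf : ContinuousAt f 0)
    (h : ∀ t : ℝ, Tendsto (fun n => ∏ i ∈ Finset.range n, (1 / (1 + (a i ^ 2 : ℝ) * (t : ℂ) ^ 2)))
      atTop (𝓝 (f t))) :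
    ∃ μ : Measure ℝ, IsProbabilityMeasure μ ∧ (∀ t, charFun μ t = f t) ∧
      Integrable (fun x => Real.exp (η * |x|)) μ := by
  -- The two equal summands of `C` come from `exp (η|x|) ≤ exp (ηx) + exp (-ηx)`.
  obtain ⟨μ, hμ, hμf, hμC⟩ := exists_charFun_eq_of_tendsto (laplaceSum a) hf
    (by simpa only [charFun_laplaceSum] using h)
    (g := fun x => (Real.exp (η * |x|)).toNNReal) (by fun_prop)
    (C := ENNReal.ofReal (Real.exp (2 * η ^ 2 * ∑' i, a i ^ 2)) +
      ENNReal.ofReal (Real.exp (2 * η ^ 2 * ∑' i, a i ^ 2))) fun n => by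
      have h1 := lintegral_exp_laplaceSum_le a ha hη n
      have h2 := lintegral_exp_laplaceSum_le a ha (η := -η) (by simpa using hη) n
      rw [neg_sq] at h2
      refine le_trans ?_ (add_le_add h1 h2)
      rw [← lintegral_add_left (by fun_prop)]
      refine lintegral_mono fun x => ?_
      change ENNReal.ofReal (Real.exp (η * |x|)) ≤ _
      rcases abs_cases x with ⟨hx, -⟩ | ⟨hx, -⟩
      · rw [hx]; exact le_self_add
      · rw [hx, mul_neg, ← neg_mul]; exact le_add_self
  refine ⟨μ, hμ, hμf, ⟨by fun_prop, ?_⟩⟩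
  rw [hasFiniteIntegral_iff_ofReal (.of_forall fun x => (Real.exp_pos _).le)]
  exact hμC.trans_lt (by simp)

theorem exists_measure_charFun_eq_inv_symbol {L : ℕ+ → ℝ} (hL : Antitone L) (hL0 : ∀ p, 0 ≤ L p) :
    ∃ μ : Measure ℝ, IsProbabilityMeasure μ ∧ (∀ t : ℝ, charFun μ t = 1 / symbol L t) ∧
      ∃ η : ℝ, 0 < η ∧ Integrable (fun x => Real.exp (η * |x|)) μ := by
  have hs := summable_sq_div_sq hL hL0
  set a : ℕ → ℝ := fun i => L i.succPNat / (i.succPNat : ℝ) with ha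
  have hsum : Summable fun i => a i ^ 2 := by
    have := hs.comp_injective Nat.succPNat_injective
    refine this.congr fun i => ?_
    simp only [ha, Function.comp_apply, div_pow]
  -- Since `a i ≤ L 1`, this `η` makes `η a_i ≤ 1/2`; the `+ 1` keeps it defined when `L 1 = 0`.
  have hη : ∀ i, (1 / (2 * (L 1 + 1)) * a i) ^ 2 ≤ 1 / 2 := by
    intro i
    have h1 : 0 ≤ L i.succPNat := hL0 _
    have h2 : L i.succPNat ≤ L 1 := hL (one_le (a := i.succPNat))
    have h3 : (1 : ℝ) ≤ (i.succPNat : ℝ) := by exact_mod_cast (i.succPNat).pos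
    have h4 : a i ≤ L 1 := (div_le_self h1 h3).trans h2
    have h5 : 0 ≤ a i := by positivity
    have h6 : 1 / (2 * (L 1 + 1)) * a i ≤ 1 / 2 := by
      have := hL0 1
      rw [div_mul_eq_mul_div, one_mul, div_le_iff₀ (by positivity)]
      linarith
    have h7 : 0 ≤ 1 / (2 * (L 1 + 1)) * a i := by have := hL0 1; positivity
    nlinarith
  have hcont : ContinuousAt (fun t : ℝ => 1 / symbol L t) 0 := by
    refine continuousAt_const.div ?_ (symbol_ofReal_ne_zero hs 0)
    exact ((differentiable_symbol hs).continuous.comp Complex.continuous_ofReal).continuousAt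
  obtain ⟨μ, hμ, hμf, hμi⟩ := exists_measure_charFun_eq a hsum hη hcont fun t => by
    have h := (Equiv.pnatEquivNat.symm.hasProd_iff.mpr (hasProd_symbol hs t)).tendsto_prod_nat
    have h' := h.inv₀ (symbol_ofReal_ne_zero hs t)
    rw [one_div]
    refine h'.congr fun n => ?_
    rw [← Finset.prod_inv_distrib]
    refine Finset.prod_congr rfl fun i _ => ?_
    rw [one_div, ha]
    simp only [Function.comp_apply, div_pow]
    rfl
  exact ⟨μ, hμ, hμf, _, by have := hL0 1; positivity, hμi⟩

/-! ### Fourier transforms on `𝒫_*(𝔻)` -/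

theorem integrable_exp_neg_mul_abs {c : ℝ} (hc : 0 < c) :
    Integrable fun x : ℝ => Real.exp (-c * |x|) := by
  have h := (integral_exp_neg_abs_mul_exp (c := 0) (by simp)).1
  simp only [zero_mul, Complex.exp_zero, mul_one] at h
  have h' : Integrable fun x : ℝ => Real.exp (-|x|) := by
    simpa only [RCLike.re_eq_complex_re, Complex.ofReal_re] using h.re
  refine (h'.comp_mul_left' hc.ne').congr (.of_forall fun x => ?_)
  simp only [abs_mul, abs_of_pos hc, neg_mul]

/-- One integrable majorant serves all derivatives, which permits Fourier transformation term by
term. -/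
theorem PStar.exists_norm_iteratedDeriv_le (φ : PStar) :
    ∃ r : ℝ, 0 < r ∧ ∃ g : ℝ → ℝ, Integrable g ∧ ∀ (k : ℕ) (x : ℝ),
      ‖iteratedDeriv k φ.1 x‖ ≤ k.factorial / r ^ k * g x := by
  obtain ⟨n, F, rfl⟩ := φ.exists_ofStep
  have hn := one_div_pnat_pos n
  obtain ⟨r, hr, i', hε, hi⟩ := exists_seminormIndex_cthickening
    (singletonIndex (ν := n) (y := 0) ⟨neg_lt_zero.mpr hn, hn⟩ (half_pos hn))
  refine ⟨r, hr, fun x => Real.exp (|1 / (n : ℝ) - 1 / (n : ℝ) / 2| * r) *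
    decaySeminorm (1 / (n : ℝ)) n i' F * Real.exp (-(1 / (n : ℝ) - 1 / (n : ℝ) / 2) * |x|),
    (integrable_exp_neg_mul_abs (by linarith)).const_mul _, fun k x => ?_⟩
  rw [iteratedDeriv_ofStep]
  simpa [singletonIndex] using F.norm_iteratedDeriv_le hε hr hi k (z := x) (mem_singleton _)

theorem PStar.continuous (φ : PStar) : Continuous φ.1 := (contDiff_pStar φ).continuous

theorem PStar.integrable_iteratedDeriv (φ : PStar) (k : ℕ) : Integrable (iteratedDeriv k φ.1) := by
  obtain ⟨r, -, g, hg, h⟩ := φ.exists_norm_iteratedDeriv_le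
  exact (hg.const_mul _).mono' ((contDiff_pStar φ).continuous_iteratedDeriv k
    (by exact_mod_cast le_top)).aestronglyMeasurable (.of_forall (h k))

theorem PStar.integrable (φ : PStar) : Integrable φ.1 := by
  simpa using φ.integrable_iteratedDeriv 0

theorem PStar.eq_zero_of_fourier_eq_zero (φ : PStar) (h : ∀ ξ, 𝓕 φ.1 ξ = 0) : φ = 0 := by
  have h0 : 𝓕 φ.1 = 0 := funext h
  have hinv := φ.continuous.fourierInv_fourier_eq φ.integrable (by
    rw [h0]; exact integrable_zero _ _ _)
  refine Subtype.ext ?_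
  change φ.1 = 0
  rw [← hinv, h0]
  ext x
  simp [Real.fourierInv_eq]

theorem integrable_exp_mul {μ : Measure ℝ} {f : ℝ → ℂ} (hf : Integrable f μ) (c : ℝ) :
    Integrable (fun x : ℝ => Complex.exp ((-2 * Real.pi * x * c : ℝ) * Complex.I) * f x) μ :=
  hf.bdd_mul (c := 1)
    (by fun_prop) (.of_forall fun x => (Complex.norm_exp_ofReal_mul_I _).le)

theorem fourier_eq_integral_exp_mul (f : ℝ → ℂ) (ξ : ℝ) :
    𝓕 f ξ = ∫ x : ℝ, Complex.exp ((-2 * Real.pi * x * ξ : ℝ) * Complex.I) * f x := by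
  rw [Real.fourier_real_eq_integral_exp_smul]
  rfl

theorem fourier_sub_of_integrable {f g : ℝ → ℂ} (hf : Integrable f) (hg : Integrable g) (ξ : ℝ) :
    𝓕 (f - g) ξ = 𝓕 f ξ - 𝓕 g ξ := by
  simp only [fourier_eq_integral_exp_mul, Pi.sub_apply, mul_sub]
  exact integral_sub (integrable_exp_mul hf ξ) (integrable_exp_mul hg ξ)

theorem hasSum_fourier_pStarOperator {a : ℕ → ℂ} (ha : IsLocalSymbol a) (φ : PStar) (ξ : ℝ) :
    HasSum (fun k => a k * (2 * Real.pi * Complex.I * ξ) ^ k * 𝓕 φ.1 ξ)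
      (𝓕 (pStarOperator ha φ).1 ξ) := by
  obtain ⟨r, hr, g, hg, hb⟩ := φ.exists_norm_iteratedDeriv_le
  set F : ℕ → ℝ → ℂ := fun k x => Complex.exp ((-2 * Real.pi * x * ξ : ℝ) * Complex.I) *
    (a k * iteratedDeriv k φ.1 x) with hF
  have hint : ∀ k, Integrable (F k) := fun k =>
    integrable_exp_mul ((φ.integrable_iteratedDeriv k).const_mul (a k)) ξ
  have hnorm : ∀ k x, ‖F k x‖ ≤ ‖a k‖ * (k.factorial / r ^ k) * g x := fun k x => by
    rw [hF, norm_mul, Complex.norm_exp_ofReal_mul_I, one_mul, norm_mul, mul_assoc]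
    exact mul_le_mul_of_nonneg_left (hb k x) (norm_nonneg _)
  have hsum : Summable fun k => ∫ x, ‖F k x‖ := by
    refine Summable.of_nonneg_of_le (fun k => integral_nonneg fun x => norm_nonneg _) (fun k => ?_)
      ((ha r hr).mul_right (∫ x, g x))
    rw [← integral_const_mul]
    exact integral_mono (hint k).norm (hg.const_mul _) (hnorm k)
  have h := hasSum_integral_of_summable_integral_norm hint hsum
  have htsum : ∫ x, ∑' k, F k x = 𝓕 (pStarOperator ha φ).1 ξ := by
    rw [fourier_eq_integral_exp_mul]
    refine integral_congr_ae (.of_forall fun x => ?_)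
    exact ((hasSum_pStarOperatorFun ha φ x).mul_left _).tsum_eq
  rw [htsum] at h
  refine h.congr_fun fun k => ?_
  have hder := congrFun (Real.fourier_iteratedDeriv (N := ⊤) (n := k) (contDiff_pStar φ)
    (fun n _ => φ.integrable_iteratedDeriv n) le_top) ξ
  rw [smul_eq_mul] at hder
  rw [mul_assoc, ← hder, fourier_eq_integral_exp_mul, ← integral_const_mul]
  refine integral_congr_ae (.of_forall fun x => ?_)
  simp only [hF]
  ring

/-! ### Convolution with a measure -/

theorem sub_ofReal_mem_strip {z : ℂ} (hz : z ∈ strip ν) (s : ℝ) : z - s ∈ strip ν := by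
  simpa [strip] using hz

theorem continuous_comp_sub_ofReal (F : DecaySpace δ ν) {z : ℂ} (hz : z ∈ strip ν) :
    Continuous fun s : ℝ => F.1 (z - s) :=
  F.2.1.continuousOn.comp_continuous (by fun_prop) (sub_ofReal_mem_strip hz)

/-- The convolution of a function on the strip with a measure on the real line. -/
def measureConv (μ : Measure ℝ) (ν : ℝ) (F : ℂ → ℂ) : ℂ → ℂ :=
  (strip ν).indicator fun z => ∫ s : ℝ, F (z - s) ∂μ

theorem differentiableOn_measureConv (μ : Measure ℝ) [IsFiniteMeasure μ] (hδ : 0 < δ)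
    (F : DecaySpace δ ν) : DifferentiableOn ℂ (measureConv μ ν F.1) (strip ν) := by
  refine DifferentiableOn.congr (f := fun z => ∫ s : ℝ, F.1 (z - s) ∂μ) ?_
    fun z hz => indicator_of_mem hz _
  intro z hz
  obtain ⟨s, hs, h1⟩ := (isCompact_singleton (x := z.im)).exists_cthickening_subset_open
    isOpen_Ioo (singleton_subset_iff.mpr hz)
  let i : SeminormIndex ν := ⟨⟨_, isCompact_singleton.cthickening, h1⟩, ⟨δ, hδ⟩⟩
  obtain ⟨r, hr, i', hε, hi⟩ := exists_seminormIndex_cthickening i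
  have hmem : ∀ w ∈ Metric.ball z s, w.im ∈ i.1.1 := fun w hw => by
    refine Metric.mem_cthickening_of_dist_le _ _ _ _ (mem_singleton _) ?_
    rw [Real.dist_eq, ← Complex.sub_im]
    exact (Complex.abs_im_le_norm _).trans (mem_ball_iff_norm.mp hw).le
  have hmem' : ∀ w ∈ Metric.ball z s, ∀ t : ℝ, (w - t).im ∈ i.1.1 := fun w hw t => by
    simpa using hmem w hw
  -- Real translations preserve `Im z`, so Cauchy's estimate for `k = 1`, taken with `ε = δ`, bounds
  -- the derivative by a constant, integrable for finite `μ`.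
  have hd := hasDerivAt_integral_of_dominated_loc_of_deriv_le (μ := μ)
    (F := fun (w : ℂ) (t : ℝ) => F.1 (w - t)) (F' := fun w t => deriv F.1 (w - t))
    (bound := fun _ => 1 / r * decaySeminorm δ ν i' F)
    (Metric.ball_mem_nhds z hs) ?_ ?_ ?_ ?_ (integrable_const _) ?_
  · exact hd.2.differentiableAt.differentiableWithinAt
  · filter_upwards [(isOpen_strip ν).mem_nhds hz] with w hw
    exact (continuous_comp_sub_ofReal F hw).aestronglyMeasurable
  · refine (integrable_const (decaySeminorm δ ν i F)).mono'
      (continuous_comp_sub_ofReal F hz).aestronglyMeasurable (.of_forall fun t => ?_)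
    simpa [i] using F.norm_le i (hmem' z (Metric.mem_ball_self hs) t)
  · exact ((F.2.1.deriv (isOpen_strip ν)).continuousOn.comp_continuous (by fun_prop)
      (sub_ofReal_mem_strip hz)).aestronglyMeasurable
  · refine .of_forall fun t w hw => ?_
    simpa [i] using F.norm_iteratedDeriv_le hε hr hi 1 (hmem' w hw t)
  · refine .of_forall fun t w hw => ?_
    have hw' : w - t ∈ strip ν := i.1.2.2 (hmem' w hw t)
    exact ((F.2.1.differentiableAt ((isOpen_strip ν).mem_nhds hw')).hasDerivAt).comp_sub_const w t

theorem measureConv_mem {μ : Measure ℝ} [IsFiniteMeasure μ] {η : ℝ}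
    (hμ : Integrable (fun x => Real.exp (η * |x|)) μ) (hδ : 0 < δ) (hδη : δ ≤ η)
    (F : DecaySpace δ ν) : measureConv μ ν F.1 ∈ decaySubmodule δ ν := by
  refine ⟨differentiableOn_measureConv μ hδ F, fun z hz => indicator_of_notMem hz _,
    fun K hK hKs ε hε => ?_⟩
  -- The minimum makes the rate `c = δ - min ε δ` nonnegative, so that `exp (-c|x - s|) ≤ exp
  -- (-c|x|) exp (c|s|)`; the last factor is integrable because `c ≤ δ ≤ η`.
  let i : SeminormIndex ν := ⟨⟨K, hK, hKs⟩, ⟨min ε δ, lt_min hε hδ⟩⟩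
  refine ⟨decaySeminorm δ ν i F * ∫ x, Real.exp (η * |x|) ∂μ, fun z hz => ?_⟩
  have h0 : 0 ≤ decaySeminorm δ ν i F := apply_nonneg _ _
  have hc0 : 0 ≤ δ - min ε δ := sub_nonneg.mpr (min_le_right _ _)
  have hcη : δ - min ε δ ≤ η := by have := (lt_min hε hδ).le; linarith
  have hce : δ - ε ≤ δ - min ε δ := by linarith [min_le_left ε δ]
  rw [measureConv, indicator_of_mem (show z ∈ strip ν from hKs hz)]
  have hle : ∀ s : ℝ, ‖F.1 (z - s)‖ ≤
      decaySeminorm δ ν i F * Real.exp (-(δ - ε) * |z.re|) * Real.exp (η * |s|) := fun s => by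
    refine (F.norm_le i (z := z - s) (by simpa using hz)).trans ?_
    rw [mul_assoc, ← Real.exp_add]
    refine mul_le_mul_of_nonneg_left (Real.exp_le_exp.mpr ?_) h0
    simp only [Complex.sub_re, Complex.ofReal_re]
    change -(δ - min ε δ) * |z.re - s| ≤ _
    have h1 : |z.re| - |s| ≤ |z.re - s| := abs_sub_abs_le_abs_sub _ _
    have h2 := mul_le_mul_of_nonneg_left h1 hc0
    have h3 := mul_le_mul_of_nonneg_right hcη (abs_nonneg s)
    have h4 := mul_le_mul_of_nonneg_right hce (abs_nonneg z.re)
    linarith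
  refine (norm_integral_le_of_norm_le (hμ.const_mul _) (.of_forall hle)).trans_eq ?_
  rw [integral_const_mul]
  ring

/-- Later steps demand less decay, so the rate can always be lowered below the exponential moment of
`μ`. -/
theorem exists_ofStep_of_le (φ : PStar) {η : ℝ} (hη : 0 < η) :
    ∃ (n : ℕ+) (F : DecaySpace (1 / (n : ℝ)) n), 1 / (n : ℝ) ≤ η ∧ ofStep n F = φ := by
  obtain ⟨n, F, rfl⟩ := φ.exists_ofStep
  obtain ⟨N, hN⟩ := exists_nat_one_div_lt hη
  have hle := le_max_left n N.succPNat
  refine ⟨max n N.succPNat, ⟨_, mem_decaySubmodule_of_le hle F.2⟩, ?_, ?_⟩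
  · refine le_trans (one_div_le_one_div_of_le (by positivity) ?_) hN.le
    have : ((N.succPNat : ℕ) : ℝ) ≤ ((max n N.succPNat : ℕ+) : ℕ) := by
      exact_mod_cast le_max_right n N.succPNat
    simpa using this
  · exact Subtype.ext (funext fun x => indicator_of_mem (ofReal_mem_strip_pnat _ x) _)

/-- Fubini applies because all translates of `φ` have the same `L¹` norm and `μ` is finite;
translation by `s` contributes the phase `exp (-2πisξ)`. -/
theorem fourier_integral_sub {μ : Measure ℝ} [IsFiniteMeasure μ] (φ : PStar) (ξ : ℝ) :
    𝓕 (fun x : ℝ => ∫ s, φ.1 (x - s) ∂μ) ξ = charFun μ (-(2 * Real.pi * ξ)) * 𝓕 φ.1 ξ := by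
  have hmeas : AEStronglyMeasurable (fun p : ℝ × ℝ => φ.1 (p.1 - p.2)) (volume.prod μ) :=
    (φ.continuous.comp (continuous_fst.sub continuous_snd)).aestronglyMeasurable
  have hprod : Integrable (fun p : ℝ × ℝ => φ.1 (p.1 - p.2)) (volume.prod μ) := by
    rw [integrable_prod_iff' hmeas]
    refine ⟨.of_forall fun s => φ.integrable.comp_sub_right s, ?_⟩
    simp only [integral_sub_right_eq_self (fun x => ‖φ.1 x‖)]
    exact integrable_const _
  have hprod' : Integrable (fun p : ℝ × ℝ => Complex.exp ((-2 * Real.pi * p.1 * ξ : ℝ) *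
      Complex.I) * φ.1 (p.1 - p.2)) (volume.prod μ) :=
    hprod.bdd_mul (c := 1) (by fun_prop)
      (.of_forall fun p => (Complex.norm_exp_ofReal_mul_I _).le)
  rw [fourier_eq_integral_exp_mul]
  simp only [← integral_const_mul]
  rw [integral_integral_swap hprod', charFun_apply_real, ← integral_mul_const]
  refine integral_congr_ae (.of_forall fun s => ?_)
  simp only [fourier_eq_integral_exp_mul]
  rw [← integral_const_mul, ← integral_add_right_eq_self _ s]
  refine integral_congr_ae (.of_forall fun x => ?_)
  simp only [add_sub_cancel_right]
  rw [← mul_assoc, ← Complex.exp_add]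
  congr 2
  push_cast
  ring

theorem exists_fourier_eq {μ : Measure ℝ} [IsFiniteMeasure μ] {η : ℝ} (hη : 0 < η)
    (hμ : Integrable (fun x => Real.exp (η * |x|)) μ) (φ : PStar) :
    ∃ ψ : PStar, ∀ ξ, 𝓕 ψ.1 ξ = charFun μ (-(2 * Real.pi * ξ)) * 𝓕 φ.1 ξ := by
  obtain ⟨n, F, hn, rfl⟩ := exists_ofStep_of_le φ hη
  refine ⟨ofStep n ⟨_, measureConv_mem hμ (one_div_pnat_pos n) hn F⟩, fun ξ => ?_⟩
  rw [← fourier_integral_sub]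
  refine congrArg (fun f : ℝ → ℂ => 𝓕 f ξ) (funext fun x => ?_)
  change measureConv μ n F.1 x = _
  rw [measureConv, indicator_of_mem (ofReal_mem_strip_pnat n x)]
  refine integral_congr_ae (.of_forall fun s => ?_)
  simp [ofStep]

/-! ### Bijectivity -/

theorem isLocalSymbol_coeff (hL : Antitone L) (hL0 : ∀ p, 0 ≤ L p) (hlim : Tendsto L atTop (𝓝 0)) :
    IsLocalSymbol fun k => coeff L k * Complex.I ^ k := fun r hr => by
  simpa using summable_norm_coeff_mul_factorial_div hL0 hlim (summable_sq_div_sq hL hL0) hr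

/-- The derivative becomes `2πiξ`, and `i · 2πiξ = -2πξ` is real: the symbol is evaluated where it
is at least `1`, at the very point where the characteristic function of `μ` appears. -/
theorem fourier_symbolOperator (hs : Summable fun p : ℕ+ => L p ^ 2 / (p : ℝ) ^ 2)
    (ha : IsLocalSymbol fun k => coeff L k * Complex.I ^ k) (φ : PStar) (ξ : ℝ) :
    𝓕 (pStarOperator ha φ).1 ξ = symbol L (-(2 * Real.pi * ξ) : ℝ) * 𝓕 φ.1 ξ := by
  refine (hasSum_fourier_pStarOperator ha φ ξ).unique
    (((hasSum_coeff hs (-(2 * Real.pi * ξ) : ℝ)).mul_right (𝓕 φ.1 ξ)).congr_fun fun k => ?_)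
  rw [mul_assoc (coeff L k), ← mul_pow]
  congr 3
  push_cast
  linear_combination (2 * Real.pi * ξ : ℂ) * Complex.I_sq

theorem bijective_symbolOperator (hL : Antitone L) (hL0 : ∀ p, 0 ≤ L p)
    (ha : IsLocalSymbol fun k => coeff L k * Complex.I ^ k) :
    Function.Bijective (pStarOperator ha) := by
  have hs := summable_sq_div_sq hL hL0
  refine ⟨(injective_iff_map_eq_zero _).mpr fun φ hφ => ?_, fun φ => ?_⟩
  · refine φ.eq_zero_of_fourier_eq_zero fun ξ => ?_
    have h := fourier_symbolOperator hs ha φ ξ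
    rw [hφ] at h
    have h0 : 𝓕 (0 : PStar).1 ξ = 0 := by
      change 𝓕 (0 : ℝ → ℂ) ξ = 0
      simp [Real.fourier_eq]
    rw [h0] at h
    exact (mul_eq_zero.mp h.symm).resolve_left (symbol_ofReal_ne_zero hs _)
  · obtain ⟨μ, hμ, hchar, η, hη, hint⟩ := exists_measure_charFun_eq_inv_symbol hL hL0
    obtain ⟨ψ, hψ⟩ := exists_fourier_eq hη hint φ
    refine ⟨ψ, sub_eq_zero.mp (PStar.eq_zero_of_fourier_eq_zero _ fun ξ => ?_)⟩
    have hsub : 𝓕 (pStarOperator ha ψ - φ).1 ξ = 𝓕 (pStarOperator ha ψ).1 ξ - 𝓕 φ.1 ξ := by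
      exact fourier_sub_of_integrable (PStar.integrable _) φ.integrable ξ
    rw [hsub, fourier_symbolOperator hs, hψ, hchar, ← mul_assoc,
      mul_one_div_cancel (symbol_ofReal_ne_zero hs _), one_mul, sub_self]

end FourierHyperfunction

end

theorem lemma2p1 (L : ℕ+ → ℝ) (hL : Antitone L) (hL0 : Filter.Tendsto L Filter.atTop (nhds 0)) :
    ∃ T : FourierHyperfunction.PStar →L[ℂ] FourierHyperfunction.PStar,
      (∀ (φ : FourierHyperfunction.PStar) (t : ℝ),
        HasSum (FourierHyperfunction.operatorTerm L Complex.I φ t) (T φ t)) ∧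
      Function.Bijective T := by
  have hpos : ∀ p, 0 ≤ L p := hL.le_of_tendsto hL0
  have ha := FourierHyperfunction.isLocalSymbol_coeff hL hpos hL0
  exact ⟨⟨FourierHyperfunction.pStarOperator ha, FourierHyperfunction.continuous_pStarOperator ha⟩,
    fun φ t => FourierHyperfunction.hasSum_pStarOperatorFun ha φ t,
    FourierHyperfunction.bijective_symbolOperator hL hpos ha⟩
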